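/- Let $l \ge 1$ and, for $n \ge l+1$, let $S_n$ be the irreducible complex representation (Specht module) of the symmetric group $\mathfrak{S}_n$ associated with the hook $(n-l,1^l)$. For a set partition $\alpha$ of $[n]=\{1,\dots,n\}$ whose part sizes form the conjugate partition $(l+1,1^{n-l-1})$ let $H_\alpha=\sum_{\tau} S_n^{\tau}$, where $\tau$ runs over the transpositions $(i\,j)$ with $i,j$ in the same part of $\alpha$ and $S_n^\tau$ is the subspace of vectors fixed by $\tau$. The intrinsic arrangement $\mathcal{A}_n$ is the set of all the hyperplanes $H_\alpha$ in $S_n$. For $n < l+1$ put $S_n=0$ and $\mathcal{A}_n=\emptyset$. The flats of $\mathcal{A}_n$ are the intersections of subsets of $\mathcal{A}_n$ (the empty intersection is $S_n$); the rank of a flat is its codimension in $S_n$, and its corank is its dimension. The Kazhdan–Lusztig polynomial of an arrangement is that of its matroid (Elias–Proudfoot–Wakefield), computed from its lattice of flats, and its first Kazhdan–Lusztig coefficient is the coefficient of $t$. For a surjection $f:[n]\to[l+1]$ the special flat $F_f$ is the intersection of all $H_\alpha$ such that $f$ is not injective on the part of $\alpha$ with $l+1$ elements. Then: 1. There is a function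 $f_l:\mathbb{N}\to\mathbb{N}$ such that for every $n\ge 0$ the first Kazhdan–Lusztig coefficient of $\mathcal{A}_n$ is at least $f_l(n)$, and $$\lim_{n\to\infty} \frac{f_l(n)\,(l+1)!}{(l+1)^n}=1 .$$ 2. For every $n \ge 0$, each special flat $F_f$ of a surjection $f:[n]\to[l+1]$ is a flat of corank one, the number of distinct flats $F_f$ of this kind is at least the Stirling number of the second kind $S(n,l+1)$, and the number of flats of rank one is exactly $\binom{n}{l+1}$. -/

import Mathlib

noncomputable section

open Finset Polynomial

set_option linter.unusedSectionVars false

/-! ### Kazhdan–Lusztig polynomials of ranked posets -/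

namespace Intrinsic

section Poset

variable {L : Type*} [PartialOrder L] [LocallyFiniteOrder L] [DecidableEq L]

/-- The characteristic polynomial `∑_{x ≤ z ≤ y} μ(x, z) t^(rk y - rk z)` of the interval `[x, y]`
of a poset with rank function `rk`. -/
def charPoly (rk : L → ℕ) (x y : L) : ℤ[X] :=
  ∑ z ∈ Icc x y, C (IncidenceAlgebra.mu ℤ x z) * X ^ (rk y - rk z)

/-- The Kazhdan–Lusztig polynomial `P_{x,y}` of the interval `[x, y]`, by the recursion of Elias,
Proudfoot and Wakefield. With `r = rk y - rk x` and `Q = ∑_{x < z ≤ y} χ_{x,z} P_{z,y}`, the equation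
`t^r P(t⁻¹) = P(t) + Q(t)` and the bound `deg P < r / 2` force the coefficient of `t^i` in
`P`, for `i < r / 2`, to be the coefficient of `t^(r - i)` in `Q`. See `isKLFamily_klPoly` and
`IsKLFamily.eq_klPoly` for the axiomatic characterization. -/
def klPoly (rk : L → ℕ) (x y : L) : ℤ[X] :=
  if x = y then 1
  else ∑ i ∈ (range (rk y - rk x)).filter (fun i => 2 * i < rk y - rk x),
    monomial i ((∑ z ∈ (Ioc x y).attach, charPoly rk x z * klPoly rk z.1 y).coeff
      (rk y - rk x - i))
termination_by (Icc x y).card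
decreasing_by
  have hz := mem_Ioc.1 z.2
  exact card_lt_card (Icc_ssubset_Icc_left (hz.1.le.trans hz.2) hz.1 le_rfl)

/-- The three defining properties of Kazhdan–Lusztig polynomials (Elias–Proudfoot–Wakefield), for
all intervals of a ranked poset: `P = 1` in rank `0`, `deg P < r / 2` in rank `r > 0`, and
`t^r P_{x,y}(t⁻¹) = ∑_{x ≤ z ≤ y} χ_{x,z}(t) P_{z,y}(t)`. -/
structure IsKLFamily (rk : L → ℕ) (P : L → L → ℤ[X]) : Prop where
  self : ∀ x, P x x = 1
  degree_lt : ∀ x y, x < y → 2 * (P x y).natDegree < rk y - rk x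
  reflect_eq : ∀ x y, x ≤ y →
    (P x y).reflect (rk y - rk x) = ∑ z ∈ Icc x y, charPoly rk x z * P z y

theorem klPoly_of_ne (rk : L → ℕ) {x y : L} (h : x ≠ y) :
    klPoly rk x y = ∑ i ∈ (range (rk y - rk x)).filter (fun i => 2 * i < rk y - rk x),
      monomial i ((∑ z ∈ Ioc x y, charPoly rk x z * klPoly rk z y).coeff (rk y - rk x - i)) := by
  rw [klPoly, if_neg h, ← sum_attach (Ioc x y) (fun z => charPoly rk x z * klPoly rk z y)]

theorem klPoly_self (rk : L → ℕ) (x : L) : klPoly rk x x = 1 := by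
  rw [klPoly, if_pos rfl]

theorem coeff_klPoly (rk : L → ℕ) {x y : L} (h : x ≠ y) (j : ℕ) :
    (klPoly rk x y).coeff j = if 2 * j < rk y - rk x then
      (∑ z ∈ Ioc x y, charPoly rk x z * klPoly rk z y).coeff (rk y - rk x - j) else 0 := by
  rw [klPoly_of_ne rk h, finsetSum_coeff]
  simp only [coeff_monomial]
  rw [sum_ite_eq']
  congr 1
  simp only [mem_filter, mem_range, eq_iff_iff]
  omega

theorem charPoly_self (rk : L → ℕ) (x : L) : charPoly rk x x = 1 := by
  simp [charPoly]

theorem natDegree_charPoly_le {rk : L → ℕ} (hrk : StrictMono rk) (x y : L) :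
    (charPoly rk x y).natDegree ≤ rk y - rk x := by
  refine natDegree_sum_le_of_forall_le _ _ fun z hz => ?_
  refine (natDegree_C_mul_X_pow_le _ _).trans ?_
  have := hrk.monotone (mem_Icc.1 hz).1
  omega

theorem reflect_sum {ι : Type*} (s : Finset ι) (f : ι → ℤ[X]) (N : ℕ) :
    (∑ i ∈ s, f i).reflect N = ∑ i ∈ s, (f i).reflect N := by
  classical
  induction s using Finset.induction_on with
  | empty => simp
  | insert a s ha ih => rw [sum_insert ha, sum_insert ha, reflect_add, ih]

theorem reflect_charPoly {rk : L → ℕ} (hrk : StrictMono rk) (x y : L) :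
    (charPoly rk x y).reflect (rk y - rk x) =
      ∑ z ∈ Icc x y, C (IncidenceAlgebra.mu ℤ x z) * X ^ (rk z - rk x) := by
  rw [charPoly, reflect_sum]
  refine sum_congr rfl fun z hz => ?_
  have h1 := hrk.monotone (mem_Icc.1 hz).1
  have h2 := hrk.monotone (mem_Icc.1 hz).2
  rw [reflect_C_mul_X_pow, revAt_le (by omega)]
  congr 2
  omega

theorem sum_Icc_comm {M : Type*} [AddCommMonoid M] (x y : L) (f : L → L → M) :
    ∑ z ∈ Icc x y, ∑ w ∈ Icc z y, f z w = ∑ w ∈ Icc x y, ∑ z ∈ Icc x w, f z w := by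
  refine sum_comm' fun z w => ?_
  simp only [mem_Icc]
  exact ⟨fun h => ⟨⟨h.1.1, h.2.1⟩, h.1.1.trans h.2.1, h.2.2⟩,
    fun h => ⟨⟨h.1.1, h.1.2.trans h.2.2⟩, h.1.2, h.2.2⟩⟩

theorem sum_reflect_charPoly_mul {rk : L → ℕ} (hrk : StrictMono rk) {x y : L} (hxy : x < y) :
    ∑ z ∈ Icc x y, (charPoly rk x z).reflect (rk z - rk x) * charPoly rk z y = 0 := by
  calc ∑ z ∈ Icc x y, (charPoly rk x z).reflect (rk z - rk x) * charPoly rk z y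
      = ∑ z ∈ Icc x y, ∑ w ∈ Icc x z,
          C (IncidenceAlgebra.mu ℤ x w) * X ^ (rk w - rk x) * charPoly rk z y := by
        refine sum_congr rfl fun z _ => ?_
        rw [reflect_charPoly hrk, sum_mul]
    _ = ∑ w ∈ Icc x y, C (IncidenceAlgebra.mu ℤ x w) * X ^ (rk w - rk x) *
          ∑ z ∈ Icc w y, charPoly rk z y := by
        rw [← sum_Icc_comm x y
          (fun w z => C (IncidenceAlgebra.mu ℤ x w) * X ^ (rk w - rk x) * charPoly rk z y)]
        exact sum_congr rfl fun w _ => (mul_sum _ _ _).symm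
    _ = ∑ w ∈ Icc x y, C (IncidenceAlgebra.mu ℤ x w) * X ^ (rk y - rk x) := by
        refine sum_congr rfl fun w hw => ?_
        have h1 := hrk.monotone (mem_Icc.1 hw).1
        have h2 := hrk.monotone (mem_Icc.1 hw).2
        have key : ∑ z ∈ Icc w y, charPoly rk z y = X ^ (rk y - rk w) := by
          simp only [charPoly]
          rw [sum_Icc_comm w y
            (fun z v => C (IncidenceAlgebra.mu ℤ z v) * (X : ℤ[X]) ^ (rk y - rk v))]
          have : ∀ v ∈ Icc w y, ∑ z ∈ Icc w v,
              C (IncidenceAlgebra.mu ℤ z v) * (X : ℤ[X]) ^ (rk y - rk v) =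
              if w = v then X ^ (rk y - rk v) else 0 := by
            intro v _
            rw [← sum_mul, ← map_sum, IncidenceAlgebra.sum_Icc_mu_left]
            split_ifs <;> simp
          rw [sum_congr rfl this, sum_ite_eq, if_pos (left_mem_Icc.2 (mem_Icc.1 hw).2)]
        rw [key, mul_assoc, ← pow_add]
        congr 2
        omega
    _ = 0 := by
        rw [← sum_mul, ← map_sum, IncidenceAlgebra.sum_Icc_mu_right, if_neg hxy.ne]
        simp

theorem natDegree_le_of_two_mul_lt {rk : L → ℕ} {P : L → L → ℤ[X]} {x y : L} (h1 : P y y = 1)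
    (h2 : x < y → 2 * (P x y).natDegree < rk y - rk x) (hxy : x ≤ y) :
    (P x y).natDegree ≤ rk y - rk x := by
  rcases hxy.eq_or_lt with rfl | h
  · simp [h1]
  · have := h2 h
    omega

theorem natDegree_klPoly_lt {rk : L → ℕ} (hrk : StrictMono rk) {x y : L} (h : x < y) :
    2 * (klPoly rk x y).natDegree < rk y - rk x := by
  have hpos := hrk h
  by_contra hcon
  have hd : (klPoly rk x y).natDegree ≠ 0 := by omega
  have h0 : (klPoly rk x y).coeff (klPoly rk x y).natDegree ≠ 0 := by
    rw [coeff_natDegree, Ne, leadingCoeff_eq_zero]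
    rintro h'
    simp [h'] at hd
  rw [coeff_klPoly rk h.ne, if_neg hcon] at h0
  exact h0 rfl

theorem reflect_klPoly {rk : L → ℕ} (hrk : StrictMono rk) (x y : L) (hxy : x ≤ y) :
    (klPoly rk x y).reflect (rk y - rk x) = ∑ z ∈ Icc x y, charPoly rk x z * klPoly rk z y := by
  induction hn : (Icc x y).card using Nat.strong_induction_on generalizing x with
  | _ n ih =>
  rcases hxy.eq_or_lt with rfl | hlt
  · simp [klPoly_self, charPoly_self, reflect_one]
  have hrlt := hrk hlt
  set r := rk y - rk x with hr
  set Q := ∑ z ∈ Ioc x y, charPoly rk x z * klPoly rk z y with hQ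
  have hIH : ∀ z ∈ Ioc x y, (klPoly rk z y).reflect (rk y - rk z) =
      ∑ w ∈ Icc z y, charPoly rk z w * klPoly rk w y := by
    intro z hz
    have hz := mem_Ioc.1 hz
    refine ih _ ?_ z hz.2 rfl
    rw [← hn]
    exact card_lt_card (Icc_ssubset_Icc_left hxy hz.1 le_rfl)
  have hdeg : ∀ z ∈ Ioc x y, (klPoly rk z y).natDegree ≤ rk y - rk z := fun z hz =>
    natDegree_le_of_two_mul_lt (klPoly_self rk y) (natDegree_klPoly_lt hrk) (mem_Ioc.1 hz).2
  have hQdeg : Q.natDegree ≤ r := by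
    refine natDegree_sum_le_of_forall_le _ _ fun z hz => ?_
    refine natDegree_mul_le.trans ?_
    have h1 := natDegree_charPoly_le hrk x z
    have h2 := hdeg z hz
    have h3 := hrk (mem_Ioc.1 hz).1
    have h4 := hrk.monotone (mem_Ioc.1 hz).2
    omega
  have hQrefl : Q.reflect r = -Q := by
    have e1 : Q.reflect r = ∑ z ∈ Ioc x y, ∑ w ∈ Icc z y,
        (charPoly rk x z).reflect (rk z - rk x) * charPoly rk z w * klPoly rk w y := by
      rw [hQ, reflect_sum]
      refine sum_congr rfl fun z hz => ?_
      have h3 := hrk (mem_Ioc.1 hz).1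
      have h4 := hrk.monotone (mem_Ioc.1 hz).2
      have : r = (rk z - rk x) + (rk y - rk z) := by omega
      rw [this, reflect_mul _ _ (natDegree_charPoly_le hrk x z) (hdeg z hz), hIH z hz, mul_sum]
      exact sum_congr rfl fun w _ => (mul_assoc _ _ _).symm
    have e2 : ∑ z ∈ Icc x y, ∑ w ∈ Icc z y,
        (charPoly rk x z).reflect (rk z - rk x) * charPoly rk z w * klPoly rk w y =
        klPoly rk x y := by
      rw [sum_Icc_comm]
      simp only [← sum_mul]
      rw [Icc_eq_cons_Ioc hxy, sum_cons, sum_eq_zero (s := Ioc x y), add_zero]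
      · simp [charPoly_self, reflect_one]
      · intro w hw
        rw [sum_reflect_charPoly_mul hrk (mem_Ioc.1 hw).1, zero_mul]
    rw [Icc_eq_cons_Ioc hxy, sum_cons, ← e1] at e2
    have e3 : ∑ w ∈ Icc x y, (charPoly rk x x).reflect (rk x - rk x) * charPoly rk x w *
        klPoly rk w y = klPoly rk x y + Q := by
      rw [Icc_eq_cons_Ioc hxy, sum_cons, hQ]
      simp [charPoly_self, reflect_one]
    rw [e3] at e2
    linear_combination e2
  rw [Icc_eq_cons_Ioc hxy, sum_cons, charPoly_self, one_mul, ← hQ]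
  ext j
  rw [coeff_reflect, coeff_add]
  have hc : ∀ i, i ≤ r → Q.coeff (r - i) = -Q.coeff i := by
    intro i hi
    have := congrArg (fun p => p.coeff i) hQrefl
    simpa [coeff_reflect, revAt_le hi] using this
  rcases le_or_gt j r with hj | hj
  · rw [revAt_le hj, coeff_klPoly rk hlt.ne, coeff_klPoly rk hlt.ne, ← hQ, ← hr]
    have hcj := hc j hj
    have hrj : r - (r - j) = j := by omega
    rw [hrj]
    rcases lt_trichotomy (2 * j) r with h | h | h
    · rw [if_neg (by omega), if_pos h, hcj]
      ring
    · rw [if_neg (by omega), if_neg (by omega)]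
      have : r - j = j := by omega
      rw [this] at hcj
      omega
    · rw [if_pos (by omega), if_neg (by omega)]
      ring
  · rw [revAt_eq_self_of_lt hj, coeff_eq_zero_of_natDegree_lt (lt_of_le_of_lt hQdeg hj)]
    ring

/-- The recursively defined polynomials have the defining properties. -/
theorem isKLFamily_klPoly {rk : L → ℕ} (hrk : StrictMono rk) : IsKLFamily rk (klPoly rk) where
  self := klPoly_self rk
  degree_lt _ _ := natDegree_klPoly_lt hrk
  reflect_eq := reflect_klPoly hrk

/-- The defining properties determine the polynomials. -/
theorem IsKLFamily.eq_klPoly {rk : L → ℕ} {P : L → L → ℤ[X]} (hP : IsKLFamily rk P) {x y : L}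
    (hxy : x ≤ y) : P x y = klPoly rk x y := by
  induction hn : (Icc x y).card using Nat.strong_induction_on generalizing x with
  | _ n ih =>
  rcases hxy.eq_or_lt with rfl | hlt
  · rw [hP.self, klPoly_self]
  have hQ : ∑ z ∈ Ioc x y, charPoly rk x z * P z y =
      ∑ z ∈ Ioc x y, charPoly rk x z * klPoly rk z y := by
    refine sum_congr rfl fun z hz => ?_
    have hz := mem_Ioc.1 hz
    rw [ih _ ?_ hz.2 rfl]
    rw [← hn]
    exact card_lt_card (Icc_ssubset_Icc_left hxy hz.1 le_rfl)
  have hrefl := hP.reflect_eq x y hxy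
  have hdeg := hP.degree_lt x y hlt
  rw [Icc_eq_cons_Ioc hxy, sum_cons, charPoly_self, one_mul, hQ] at hrefl
  ext i
  rw [coeff_klPoly rk hlt.ne]
  split_ifs with hi
  · have := congrArg (fun p => p.coeff (rk y - rk x - i)) hrefl
    simp only [coeff_reflect, coeff_add] at this
    rw [revAt_le (by omega), coeff_eq_zero_of_natDegree_lt
      (show (P x y).natDegree < rk y - rk x - i by omega), zero_add] at this
    rw [← this]
    congr 1
    omega
  · exact coeff_eq_zero_of_natDegree_lt (by omega)

end Poset

/-! ### Hyperplane arrangements -/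

section Arrangement

variable {V : Type*} [AddCommGroup V] [Module ℂ V]

open Classical in
/-- The flats of a finite central arrangement: all intersections of its members. The empty
intersection is the whole space. -/
def flats (𝒜 : Finset (Submodule ℂ V)) : Finset (Submodule ℂ V) :=
  𝒜.powerset.image fun ℬ => ℬ.inf id

/-- The lattice of flats, ordered by reverse inclusion. -/
abbrev FlatLattice (𝒜 : Finset (Submodule ℂ V)) : Type _ := {F // F ∈ flats 𝒜}ᵒᵈ

instance instLocallyFiniteOrderFlatLattice (𝒜 : Finset (Submodule ℂ V)) :
    LocallyFiniteOrder (FlatLattice 𝒜) := by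
  classical exact Fintype.toLocallyFiniteOrder

/-- The matroidal rank of a flat is its codimension. -/
def flatRank (𝒜 : Finset (Submodule ℂ V)) (F : FlatLattice 𝒜) : ℕ :=
  Module.finrank ℂ (V ⧸ (OrderDual.ofDual F).1)

theorem inf_mem_flats {𝒜 ℬ : Finset (Submodule ℂ V)} (h : ℬ ⊆ 𝒜) : ℬ.inf id ∈ flats 𝒜 := by
  classical exact mem_image_of_mem _ (mem_powerset.2 h)

/-- The bottom of the lattice of flats: the whole space. -/
def wholeFlat (𝒜 : Finset (Submodule ℂ V)) : FlatLattice 𝒜 :=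
  OrderDual.toDual ⟨(∅ : Finset (Submodule ℂ V)).inf id, inf_mem_flats (empty_subset _)⟩

/-- The top of the lattice of flats: the intersection of all the hyperplanes. -/
def centerFlat (𝒜 : Finset (Submodule ℂ V)) : FlatLattice 𝒜 :=
  OrderDual.toDual ⟨𝒜.inf id, inf_mem_flats subset_rfl⟩

open Classical in
/-- The flats of matroidal rank `k`, that is, of codimension `k`. -/
def flatsOfRank (𝒜 : Finset (Submodule ℂ V)) (k : ℕ) : Finset (Submodule ℂ V) :=
  (flats 𝒜).filter fun F => Module.finrank ℂ (V ⧸ F) = k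

open Classical in
/-- The flats of matroidal corank `k`, that is, of dimension `k`. -/
def flatsOfCorank (𝒜 : Finset (Submodule ℂ V)) (k : ℕ) : Finset (Submodule ℂ V) :=
  (flats 𝒜).filter fun F => Module.finrank ℂ F = k

open Classical in
/-- The Kazhdan–Lusztig polynomial of an arrangement. -/
def klPolynomial (𝒜 : Finset (Submodule ℂ V)) : ℤ[X] :=
  klPoly (flatRank 𝒜) (wholeFlat 𝒜) (centerFlat 𝒜)

/-- The first Kazhdan–Lusztig coefficient. -/
def firstKLCoeff (𝒜 : Finset (Submodule ℂ V)) : ℤ := (klPolynomial 𝒜).coeff 1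

theorem flatRank_strictMono [FiniteDimensional ℂ V] (𝒜 : Finset (Submodule ℂ V)) :
    StrictMono (flatRank 𝒜) := by
  intro F G h
  have h' : (OrderDual.ofDual G).1 < (OrderDual.ofDual F).1 := h
  have h1 := Submodule.finrank_lt_finrank_of_lt h'
  have h2 := Submodule.finrank_quotient_add_finrank (OrderDual.ofDual F).1
  have h3 := Submodule.finrank_quotient_add_finrank (OrderDual.ofDual G).1
  simp only [flatRank]
  omega

end Arrangement

/-! ### Specht modules -/

section Specht

/-- A tableau of shape `μ` with entries in `[n]`. There is one only if `μ` has `n` cells. -/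
abbrev Tableau (μ : YoungDiagram) (n : ℕ) : Type := {c // c ∈ μ.cells} ≃ Fin n

/-- The tabloid `{T}`, encoded as the function that sends each entry to its row: two tableaux have
the same tabloid if and only if they differ by a permutation that preserves the rows. -/
def tabloid {μ : YoungDiagram} {n : ℕ} (T : Tableau μ n) : Fin n → ℕ :=
  fun k => (T.symm k).1.1

/-- The vector space of functions `([n] → ℕ) → ℂ`. It contains the permutation module `M^μ` as the
span of the indicator functions of the tabloids of shape `μ`. -/
abbrev TabloidSpace (n : ℕ) : Type := (Fin n → ℕ) → ℂ

/-- The action of a permutation. It sends the indicator function of `{T}` to that of `{σ(T)}`, see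
`permAct_tabloid`. -/
def permAct {n : ℕ} (σ : Equiv.Perm (Fin n)) : TabloidSpace n →ₗ[ℂ] TabloidSpace n :=
  LinearMap.funLeft ℂ ℂ fun r => r ∘ σ

theorem permAct_tabloid {μ : YoungDiagram} {n : ℕ} (σ : Equiv.Perm (Fin n)) (T : Tableau μ n) :
    permAct σ (Pi.single (tabloid T) 1) = Pi.single (tabloid (T.trans σ)) 1 := by
  ext r
  rw [permAct, LinearMap.funLeft_apply, Pi.single_apply, Pi.single_apply]
  congr 1
  have h : tabloid (T.trans σ) = tabloid T ∘ σ.symm := rfl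
  rw [h, Equiv.eq_comp_symm]

/-- The group `C(T)` of permutations of the entries that preserve the columns of `T`. -/
def columnStabilizer {μ : YoungDiagram} {n : ℕ} (T : Tableau μ n) :
    Finset (Equiv.Perm (Fin n)) :=
  univ.filter fun σ => ∀ k, (T.symm (σ k)).1.2 = (T.symm k).1.2

/-- `v_T = ∑_{σ ∈ C(T)} sgn(σ) {σ(T)}`. -/
def polytabloid {μ : YoungDiagram} {n : ℕ} (T : Tableau μ n) : TabloidSpace n :=
  ∑ σ ∈ columnStabilizer T, ((Equiv.Perm.sign σ : ℤ) : ℂ) • Pi.single (tabloid (T.trans σ)) 1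

/-- The Specht module `S^μ`, zero if `μ` does not have `n` cells. -/
def specht (μ : YoungDiagram) (n : ℕ) : Submodule ℂ (TabloidSpace n) :=
  Submodule.span ℂ (Set.range fun T : Tableau μ n => polytabloid T)

/-- The subspace `(S^μ)^σ` of vectors fixed by `σ`. -/
def fixedSubspace (μ : YoungDiagram) (n : ℕ) (σ : Equiv.Perm (Fin n)) :
    Submodule ℂ (specht μ n) :=
  (LinearMap.eqLocus (permAct σ) LinearMap.id).comap (specht μ n).subtype

instance instFiniteDimensionalSpecht (μ : YoungDiagram) (n : ℕ) :
    FiniteDimensional ℂ (specht μ n) :=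
  FiniteDimensional.span_of_finite ℂ (Set.finite_range _)

theorem specht_eq_bot {μ : YoungDiagram} {n : ℕ} (h : μ.card ≠ n) : specht μ n = ⊥ := by
  have : IsEmpty (Tableau μ n) := ⟨fun T => h (by simpa using Fintype.card_congr T)⟩
  rw [specht, Set.range_eq_empty, Submodule.span_empty]

end Specht

/-! ### Intrinsic arrangements -/

section IntrinsicArrangement

/-- The partitions of the set `[n]` whose part sizes are the row lengths of `ν`. -/
def setPartitions (ν : YoungDiagram) (n : ℕ) : Finset (Finpartition (univ : Finset (Fin n))) :=
  univ.filter fun α => α.parts.val.map Finset.card = (ν.rowLens : Multiset ℕ)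

/-- `H_α`: the sum of the subspaces `(S^μ)^τ` over all transpositions `τ = (i j)` with `i` and `j` in
the same part of `α`. -/
def intrinsicHyperplane (μ : YoungDiagram) (n : ℕ) (α : Finpartition (univ : Finset (Fin n))) :
    Submodule ℂ (specht μ n) :=
  ⨆ (i : Fin n) (j : Fin n) (_ : i ≠ j ∧ ∃ p ∈ α.parts, i ∈ p ∧ j ∈ p),
    fixedSubspace μ n (Equiv.swap i j)

open Classical in
/-- The intrinsic arrangement of `S^μ`: the hyperplanes `H_α`, for the set partitions `α` whose shape
is the conjugate of `μ`. -/
def intrinsicArrangement (μ : YoungDiagram) (n : ℕ) : Finset (Submodule ℂ (specht μ n)) :=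
  (setPartitions μ.transpose n).image (intrinsicHyperplane μ n)

/-- The padded partition `lam[n] = (n - |lam|, lam)`, for `n ≥ |lam| + lam₁`. For smaller `n` it is
replaced by `(lam₁, lam)`, which has `|lam| + lam₁ ≠ n` cells, so that its Specht module for `[n]` is
zero, and its arrangement is empty. -/
def padded (lam : YoungDiagram) (n : ℕ) : YoungDiagram :=
  YoungDiagram.ofRowLens (max (n - lam.card) (lam.rowLen 0) :: lam.rowLens) <| by
    rw [List.sortedGE_iff_pairwise, List.pairwise_cons]
    refine ⟨fun x hx => ?_, lam.rowLens_sorted.pairwise⟩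
    obtain ⟨i, -, rfl⟩ := List.mem_map.1 hx
    exact (lam.rowLen_anti 0 i (Nat.zero_le i)).trans (le_max_right _ _)

/-- The partition `(1^l)`. -/
def column (l : ℕ) : YoungDiagram :=
  YoungDiagram.ofRowLens (List.replicate l 1) <| by
    rw [List.sortedGE_iff_pairwise]
    exact List.pairwise_replicate_of_refl

/-- The hook `lam[n] = (n - l, 1^l)`, where `lam = (1^l)`. -/
abbrev hook (l n : ℕ) : YoungDiagram := padded (column l) n

/-- The intrinsic arrangement `𝒜_n` of the hook `(n - l, 1^l)`. -/
abbrev hookArrangement (l n : ℕ) : Finset (Submodule ℂ (specht (hook l n) n)) :=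
  intrinsicArrangement (hook l n) n

/-- The special flat `F_f` of a surjection `f : [n] → [m]`: the intersection of all `H_α` such that
`|f(p)| < l + 1`, where `p` is the part of `α` with `l + 1` elements. -/
def specialFlat (l n : ℕ) {m : ℕ} (f : Fin n → Fin m) : Submodule ℂ (specht (hook l n) n) :=
  ((setPartitions (hook l n).transpose n).filter fun α =>
    ∃ p ∈ α.parts, p.card = l + 1 ∧ (p.image f).card < l + 1).inf (intrinsicHyperplane (hook l n) n)

open Classical in
/-- The special flats `F_f` of all surjections `f : [n] → [m]`. -/
def specialFlats (l n m : ℕ) : Finset (Submodule ℂ (specht (hook l n) n)) :=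
  (univ.filter fun f : Fin n → Fin m => Function.Surjective f).image (specialFlat l n)

end IntrinsicArrangement

end Intrinsic

end

/-! The polytabloid of a hook depends, up to sign, only on the set $p$ of the $l+1$ entries in the
first column; it behaves like the boundary of the simplex with vertex set $p$. The first point is
that $H_\alpha$ is the orthogonal complement of this polytabloid, where $p$ is the large part of
$\alpha$ (`mem_hyperplaneOf_image`). A vector fixed by a transposition inside $p$ pairs to minus
itself, hence to zero. Conversely, if $v$ pairs to zero, its antisymmetrization over
$\mathfrak{S}_p$ vanishes, so $(l+1)!\,v=\sum_\sigma (v-\mathrm{sgn}(\sigma)\sigma v)$, and each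
summand telescopes into vectors fixed by transpositions.

The pairings $v\mapsto\langle v,e_c\rangle$ with all words $c$ separate the points of $S_n$ and
satisfy the boundary relation `sum_hookForm_update`. On $F_f$ the pairing vanishes unless $c$ meets
each fibre of $f$ once, and the boundary relation makes it constant on sections of $f$. So $\dim
F_f\le 1$; the sum of the polytabloids of all sections is a nonzero element. This vector pairs
nontrivially with exactly the transversals of the fibres, so $F_f$ determines the kernel of $f$,
which gives at least $S(n,l+1)$ flats of corank one. Suitable vectors of the same kind show that
distinct sets $p$ give distinct hyperplanes, so there are $\binom{n}{l+1}$ flats of rank one.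

In rank greater than two the first Kazhdan–Lusztig coefficient is the number of coatoms minus the
number of atoms (`coeff_one_klPoly`), so $S(n,l+1)-\binom{n}{l+1}$ is a lower bound; it persists in
small rank, where the coefficient is zero. The binomial coefficient is polynomial in $n$, and
$S(n,m)\,m!\sim m^n$. -/

namespace Intrinsic

open Finset Polynomial

/-! ### Stirling numbers of the second kind -/

section Stirling

/-- One labelled surjection for each set partition into $k$ blocks. The recursion follows the
Stirling recurrence: the new element joins one of the existing fibres, or is a fibre by itself. -/
theorem exists_surjections_card_eq_stirlingSecond (n k : ℕ) :
    ∃ A : Finset (Fin n → Fin k), (∀ f ∈ A, Function.Surjective f) ∧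
      (∀ f ∈ A, ∀ g ∈ A, (∀ a b, f a = f b ↔ g a = g b) → f = g) ∧
      A.card = Nat.stirlingSecond n k := by
  induction n generalizing k with
  | zero =>
    cases k with
    | zero =>
      exact ⟨univ, fun f _ x => x.elim0, fun f _ g _ _ => Subsingleton.elim _ _, by simp⟩
    | succ k => exact ⟨∅, by simp, by simp, by simp⟩
  | succ n ih =>
    cases k with
    | zero => exact ⟨∅, by simp, by simp, by simp⟩
    | succ k =>
      obtain ⟨A, hA1, hA2, hA3⟩ := ih (k + 1)
      obtain ⟨B, hB1, hB2, hB3⟩ := ih k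
      let Φ : Fin (k + 1) × (Fin n → Fin (k + 1)) → (Fin (n + 1) → Fin (k + 1)) :=
        fun p => Fin.cons p.1 p.2
      let Ψ : (Fin n → Fin k) → (Fin (n + 1) → Fin (k + 1)) :=
        fun g => Fin.cons 0 (Fin.succ ∘ g)
      have hΦ : Function.Injective Φ := by
        rintro ⟨i, f⟩ ⟨j, g⟩ h
        have := Fin.cons_injective2 h
        exact Prod.ext this.1 this.2
      have hΨ : Function.Injective Ψ := by
        intro f g h
        have := (Fin.cons_injective2 h).2
        exact (Fin.succ_injective k).comp_left this
      -- The element 0 shares its fibre under `Φ (i, f)` and is alone in its fibre under `Ψ g`, so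
      -- the two kernels differ.
      have key : ∀ i, ∀ f ∈ A, ∀ g ∈ B, ¬ ∀ a b, Φ (i, f) a = Φ (i, f) b ↔ Ψ g a = Ψ g b := by
        intro i f hf g _ h
        obtain ⟨a, ha⟩ := hA1 f hf i
        have := (h 0 a.succ).1 (by simp [Φ, ha])
        simp only [Ψ, Fin.cons_zero, Fin.cons_succ, Function.comp_apply] at this
        exact (Fin.succ_ne_zero _ this.symm)
      refine ⟨(univ ×ˢ A).image Φ ∪ B.image Ψ, ?_, ?_, ?_⟩
      · intro f hf
        simp only [mem_union, mem_image, mem_product, mem_univ, true_and, Prod.exists] at hf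
        rcases hf with ⟨i, f, hf, rfl⟩ | ⟨g, hg, rfl⟩
        · intro x
          obtain ⟨a, ha⟩ := hA1 f hf x
          exact ⟨a.succ, by simp [Φ, ha]⟩
        · intro x
          refine Fin.cases ⟨0, by simp [Ψ]⟩ (fun y => ?_) x
          obtain ⟨a, ha⟩ := hB1 g hg y
          exact ⟨a.succ, by simp [Ψ, ha]⟩
      · intro f hf g hg h
        simp only [mem_union, mem_image, mem_product, mem_univ, true_and, Prod.exists] at hf hg
        rcases hf with ⟨i, f, hf, rfl⟩ | ⟨f, hf, rfl⟩ <;>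
          rcases hg with ⟨j, g, hg, rfl⟩ | ⟨g, hg, rfl⟩
        · have hfg : f = g := hA2 f hf g hg fun a b => by simpa [Φ] using h a.succ b.succ
          subst hfg
          obtain ⟨a, ha⟩ := hA1 f hf i
          have : j = f a := by simpa [Φ] using (h 0 a.succ).1 (by simp [Φ, ha])
          rw [this, ha]
        · exact (key i f hf g hg h).elim
        · exact (key j g hg f hf fun a b => (h a b).symm).elim
        · congr 1
          exact hB2 f hf g hg fun a b => by simpa [Ψ] using h a.succ b.succ
      · rw [card_union_of_disjoint, card_image_of_injective _ hΦ, card_image_of_injective _ hΨ,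
          card_product, hA3, hB3, card_univ, Fintype.card_fin, Nat.stirlingSecond_succ_succ]
        rw [disjoint_left]
        intro f hf hg
        simp only [mem_image, mem_product, mem_univ, true_and, Prod.exists] at hf hg
        obtain ⟨i, f, hf, rfl⟩ := hf
        obtain ⟨g, hg, he⟩ := hg
        exact key i f hf g hg fun a b => by rw [he]

/-- Both sides count the maps $[n]\to[m]$, on the left by the number of fibres. The induction uses
$m\,(m)_k=(m)_{k+1}+k\,(m)_k$. -/
theorem sum_stirlingSecond_mul_descFactorial (n m : ℕ) :
    ∑ k ∈ range (m + 1), Nat.stirlingSecond n k * m.descFactorial k = m ^ n := by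
  induction n with
  | zero =>
    rw [sum_range_succ']
    simp
  | succ n ih =>
    have h1 : ∑ k ∈ range m, Nat.stirlingSecond n k * m.descFactorial (k + 1) +
        ∑ k ∈ range (m + 1), k * (Nat.stirlingSecond n k * m.descFactorial k) = m * m ^ n := by
      rw [← ih, mul_sum, ← add_zero (∑ k ∈ range m, _),
        -- The missing term $k=m$ is zero because $(m)_{m+1}=0$; adding it makes the two ranges
        -- agree.
        show 0 = Nat.stirlingSecond n m * m.descFactorial (m + 1) by
          rw [Nat.descFactorial_of_lt (Nat.lt_succ_self m), mul_zero],
        ← sum_range_succ (fun k => Nat.stirlingSecond n k * m.descFactorial (k + 1)),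
        ← sum_add_distrib]
      refine sum_congr rfl fun k hk => ?_
      obtain ⟨d, rfl⟩ := Nat.exists_eq_add_of_le (Nat.lt_succ_iff.1 (mem_range.1 hk))
      rw [Nat.descFactorial_succ, Nat.add_sub_cancel_left]
      ring
    rw [pow_succ', ← h1, sum_range_succ', sum_range_succ' (fun k =>
      k * (Nat.stirlingSecond n k * m.descFactorial k))]
    simp only [Nat.stirlingSecond_succ_succ, Nat.stirlingSecond_succ_zero, zero_mul, add_zero]
    rw [← sum_add_distrib]
    exact sum_congr rfl fun k _ => by ring

theorem stirlingSecond_mul_factorial_le (n k : ℕ) :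
    Nat.stirlingSecond n k * k.factorial ≤ k ^ n := by
  rw [← sum_stirlingSecond_mul_descFactorial n k, ← Nat.descFactorial_self k]
  exact single_le_sum (f := fun j => Nat.stirlingSecond n j * k.descFactorial j)
    (fun _ _ => Nat.zero_le _) (self_mem_range_succ k)

theorem stirlingSecond_le_pow (n k : ℕ) : Nat.stirlingSecond n k ≤ k ^ n :=
  (Nat.le_mul_of_pos_right _ k.factorial_pos).trans (stirlingSecond_mul_factorial_le n k)

open Filter Topology in
theorem tendsto_stirlingSecond_div_pow_of_lt {k m : ℕ} (h : k < m) :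
    Tendsto (fun n => (Nat.stirlingSecond n k : ℝ) / (m : ℝ) ^ n) atTop (𝓝 0) := by
  have hm : (0 : ℝ) < m := by exact_mod_cast (Nat.zero_le k).trans_lt h
  refine squeeze_zero (fun n => by positivity) (fun n => ?_)
    (tendsto_pow_atTop_nhds_zero_of_lt_one (r := (k : ℝ) / m) (by positivity)
      ((div_lt_one hm).2 (by exact_mod_cast h)))
  rw [div_pow]
  gcongr
  exact_mod_cast stirlingSecond_le_pow n k

open Filter Topology in
-- In $m^n=\sum_k S(n,k)(m)_k$ the terms with $k<m$ are $O(k^n)$, so only $k=m$ survives division by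
-- $m^n$.
theorem tendsto_stirlingSecond_mul_factorial_div_pow {m : ℕ} (hm : 0 < m) :
    Tendsto (fun n => (Nat.stirlingSecond n m : ℝ) * (m.factorial : ℝ) / (m : ℝ) ^ n)
      atTop (𝓝 1) := by
  have hm' : (m : ℝ) ≠ 0 := by exact_mod_cast hm.ne'
  have h0 : Tendsto (fun n => 1 - ∑ k ∈ range m,
      (Nat.stirlingSecond n k : ℝ) / (m : ℝ) ^ n * (m.descFactorial k : ℝ)) atTop (𝓝 1) := by
    have : Tendsto (fun n => ∑ k ∈ range m,
        (Nat.stirlingSecond n k : ℝ) / (m : ℝ) ^ n * (m.descFactorial k : ℝ)) atTop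
        (𝓝 (∑ k ∈ range m, 0 * (m.descFactorial k : ℝ))) :=
      tendsto_finsetSum _ fun k hk =>
        (tendsto_stirlingSecond_div_pow_of_lt (mem_range.1 hk)).mul_const _
    simpa using this.const_sub 1
  refine h0.congr fun n => ?_
  have h := sum_stirlingSecond_mul_descFactorial n m
  rw [sum_range_succ, Nat.descFactorial_self] at h
  have h' : ∑ k ∈ range m, (Nat.stirlingSecond n k : ℝ) * (m.descFactorial k : ℝ) +
      (Nat.stirlingSecond n m : ℝ) * (m.factorial : ℝ) = (m : ℝ) ^ n := by exact_mod_cast h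
  have h2 : ∑ k ∈ range m, (Nat.stirlingSecond n k : ℝ) / (m : ℝ) ^ n * (m.descFactorial k : ℝ) =
      (∑ k ∈ range m, (Nat.stirlingSecond n k : ℝ) * (m.descFactorial k : ℝ)) / (m : ℝ) ^ n := by
    rw [sum_div]
    exact sum_congr rfl fun k _ => by ring
  have hp : (m : ℝ) ^ n ≠ 0 := pow_ne_zero _ hm'
  rw [h2, eq_div_iff hp, sub_mul, div_mul_cancel₀ _ hp]
  linarith

open Filter Topology in
theorem tendsto_choose_div_pow (k : ℕ) {m : ℝ} (hm : 1 < m) :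
    Tendsto (fun n : ℕ => (n.choose k : ℝ) / m ^ n) atTop (𝓝 0) := by
  refine squeeze_zero (fun n => by positivity) (fun n => ?_)
    (tendsto_pow_const_div_const_pow_of_one_lt k hm)
  gcongr
  exact_mod_cast Nat.choose_le_pow n k

/-- Ensures that the natural subtraction in the final bound does not truncate. Pascal's rule is
compared with the Stirling recurrence; since the inequality fails for $k=1$, the step for $k=2$
needs the separate bound `h2`. -/
theorem choose_le_stirlingSecond (n : ℕ) {k : ℕ} (hk : 2 ≤ k) :
    n.choose k ≤ Nat.stirlingSecond n k := by
  have h2 : ∀ n : ℕ, n ≤ Nat.stirlingSecond n 2 + 1 := by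
    intro n
    induction n with
    | zero => simp
    | succ n ih =>
      have h : Nat.stirlingSecond (n + 1) 2 =
        2 * Nat.stirlingSecond n 2 + Nat.stirlingSecond n 1 := rfl
      cases n with
      | zero => simp
      | succ n =>
        rw [Nat.stirlingSecond_one_right] at h
        omega
  induction n generalizing k with
  | zero => rw [Nat.choose_eq_zero_of_lt (by omega)]; exact Nat.zero_le _
  | succ n ih =>
    obtain ⟨k, rfl⟩ : ∃ j, k = j + 1 := ⟨k - 1, by omega⟩
    rw [Nat.choose_succ_succ, Nat.stirlingSecond_succ_succ]
    have h1 := ih hk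
    rcases Nat.lt_or_ge 1 k with h | h
    · have h3 := ih (k := k) h
      nlinarith
    · obtain rfl : k = 1 := by omega
      have h3 := h2 n
      change n.choose 2 ≤ Nat.stirlingSecond n 2 at h1
      change n.choose 1 + n.choose 2 ≤ 2 * Nat.stirlingSecond n 2 + Nat.stirlingSecond n 1
      rw [Nat.choose_one_right]
      cases n with
      | zero => simp
      | succ n =>
        rw [Nat.stirlingSecond_one_right]
        omega

end Stirling

/-! ### The first Kazhdan–Lusztig coefficient -/

section FirstCoeff

variable {L : Type*} [PartialOrder L] [LocallyFiniteOrder L] [DecidableEq L]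

theorem coeff_charPoly (rk : L → ℕ) (x y : L) (j : ℕ) :
    (charPoly rk x y).coeff j =
      ∑ z ∈ (Icc x y).filter (fun z => rk y - rk z = j), IncidenceAlgebra.mu ℤ x z := by
  rw [charPoly, finsetSum_coeff, sum_filter]
  refine sum_congr rfl fun z _ => ?_
  rw [coeff_C_mul_X_pow]
  simp only [eq_comm]

theorem coeff_charPoly_top {rk : L → ℕ} (hrk : StrictMono rk) {x y : L} (hxy : x ≤ y) :
    (charPoly rk x y).coeff (rk y - rk x) = 1 := by
  rw [coeff_charPoly, show (Icc x y).filter (fun z => rk y - rk z = rk y - rk x) = {x} from ?_]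
  · simp
  · ext z
    simp only [mem_filter, mem_Icc, mem_singleton]
    constructor
    · rintro ⟨⟨h1, h2⟩, h3⟩
      by_contra hne
      have h4 := hrk (h1.lt_of_ne' hne)
      have h5 := hrk.monotone h2
      omega
    · rintro rfl
      exact ⟨⟨le_rfl, hxy⟩, rfl⟩

theorem mu_eq_neg_one {rk : L → ℕ} (hrk : StrictMono rk) {x z : L} (hxz : x ≤ z)
    (h : rk z = rk x + 1) : IncidenceAlgebra.mu ℤ x z = -1 := by
  have hne : x ≠ z := by rintro rfl; omega
  have hI : Icc x z = {x, z} := by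
    ext w
    simp only [mem_Icc, mem_insert, mem_singleton]
    constructor
    · rintro ⟨h1, h2⟩
      by_contra hcon
      rw [not_or] at hcon
      have h3 := hrk (h1.lt_of_ne' hcon.1)
      have h4 := hrk (h2.lt_of_ne hcon.2)
      omega
    · rintro (rfl | rfl)
      · exact ⟨le_rfl, hxz⟩
      · exact ⟨hxz, le_rfl⟩
  have h2 := IncidenceAlgebra.sum_Icc_mu_right (𝕜 := ℤ) x z
  rw [hI, sum_pair hne, if_neg hne] at h2
  simp only [IncidenceAlgebra.mu_self] at h2
  linarith

theorem klPoly_eq_one {rk : L → ℕ} (hrk : StrictMono rk) {z y : L} (hzy : z ≤ y)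
    (h : rk y = rk z + 1) : klPoly rk z y = 1 := by
  have hlt : z < y := hzy.lt_of_ne (by rintro rfl; omega)
  have hd := natDegree_klPoly_lt hrk hlt
  have hI : Ioc z y = {y} := by
    ext w
    simp only [mem_Ioc, mem_singleton]
    constructor
    · rintro ⟨h1, h2⟩
      by_contra hcon
      have h3 := hrk h1
      have h4 := hrk (h2.lt_of_ne hcon)
      omega
    · rintro rfl
      exact ⟨hlt, le_rfl⟩
  rw [eq_C_of_natDegree_eq_zero (p := klPoly rk z y) (by omega), coeff_klPoly rk hlt.ne,
    if_pos (by omega), hI, sum_singleton, klPoly_self, mul_one, Nat.sub_zero,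
    coeff_charPoly_top hrk hzy, C_1]

/-- The first Kazhdan–Lusztig coefficient is the number of coatoms minus the number of atoms. -/
theorem coeff_one_klPoly {rk : L → ℕ} (hrk : StrictMono rk) {x y : L} (hxy : x ≤ y)
    (h : 2 < rk y - rk x) :
    (klPoly rk x y).coeff 1 = (((Icc x y).filter fun z => rk z + 1 = rk y).card : ℤ) -
      ((Icc x y).filter fun z => rk z = rk x + 1).card := by
  have hne : x ≠ y := by rintro rfl; omega
  -- If $z$ has corank $d\ge 2$ below $y$, the product has degree less than $(r-d)+d/2\le r-1$,
  -- where $r$ is the rank of the interval. Thus only coatoms, with leading coefficient 1, and $z=y$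
  -- contribute; the latter gives the sum of $\mu$ over the atoms.
  have hterm : ∀ z ∈ Ioc x y, (charPoly rk x z * klPoly rk z y).coeff (rk y - rk x - 1) =
      (if rk z + 1 = rk y then 1 else 0) +
      if z = y then (charPoly rk x y).coeff (rk y - rk x - 1) else 0 := by
    intro z hz
    obtain ⟨h1, h2⟩ := mem_Ioc.1 hz
    by_cases hzy : z = y
    · subst hzy
      simp [klPoly_self]
    · have h3 := hrk h1
      have h4 := hrk (h2.lt_of_ne hzy)
      rw [if_neg hzy, add_zero]
      split_ifs with h5
      · rw [klPoly_eq_one hrk h2 h5.symm, mul_one,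
          show rk y - rk x - 1 = rk z - rk x by omega, coeff_charPoly_top hrk h1.le]
      · refine coeff_eq_zero_of_natDegree_lt (natDegree_mul_le.trans_lt ?_)
        have h6 := natDegree_charPoly_le hrk x z
        have h7 := natDegree_klPoly_lt hrk (h2.lt_of_ne hzy)
        omega
  rw [coeff_klPoly rk hne, if_pos (by omega), finsetSum_coeff, sum_congr rfl hterm,
    sum_add_distrib, sum_ite_eq', if_pos (mem_Ioc.2 ⟨hxy.lt_of_ne hne, le_rfl⟩), sub_eq_add_neg]
  congr 1
  · rw [card_eq_sum_ones, Nat.cast_sum, sum_filter, Icc_eq_cons_Ioc hxy, sum_cons,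
      if_neg (by omega), zero_add]
    simp
  · rw [coeff_charPoly, card_eq_sum_ones, Nat.cast_sum, ← sum_neg_distrib]
    refine sum_congr ?_ fun z hz => ?_
    · refine filter_congr fun z hz => ?_
      have h1 := hrk.monotone (mem_Icc.1 hz).1
      have h2 := hrk.monotone (mem_Icc.1 hz).2
      omega
    · rw [mem_filter] at hz
      rw [mu_eq_neg_one hrk (mem_Icc.1 hz.1).1 hz.2]
      simp

end FirstCoeff

/-! ### Hooks -/

section Hook

theorem mem_column {l : ℕ} {c : ℕ × ℕ} : c ∈ column l ↔ c.1 < l ∧ c.2 = 0 := by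
  simp [column, YoungDiagram.mem_ofRowLens]

theorem card_column (l : ℕ) : (column l).card = l := by
  have : (column l).cells = range l ×ˢ {0} := by
    ext c
    rw [YoungDiagram.mem_cells, mem_column, mem_product, mem_range, mem_singleton]
  rw [YoungDiagram.card, this, card_product, card_range, card_singleton, mul_one]

theorem rowLens_column (l : ℕ) : (column l).rowLens = List.replicate l 1 :=
  YoungDiagram.rowLens_ofRowLens_eq_self fun x hx => by simp [List.eq_of_mem_replicate hx]

theorem rowLen_zero_column {l : ℕ} (hl : 1 ≤ l) : (column l).rowLen 0 = 1 := by
  have h (j : ℕ) : j < (column l).rowLen 0 ↔ j = 0 := by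
    rw [← YoungDiagram.mem_iff_lt_rowLen, mem_column]
    simp only [and_iff_right_iff_imp]
    omega
  have h0 := (h 0).2 rfl
  have h1 := h 1
  omega

theorem mem_hook {l : ℕ} (hl : 1 ≤ l) {n : ℕ} {c : ℕ × ℕ} :
    c ∈ hook l n ↔ (c.1 = 0 ∧ c.2 < max (n - l) 1) ∨ (1 ≤ c.1 ∧ c.1 ≤ l ∧ c.2 = 0) := by
  rw [hook, padded, YoungDiagram.mem_ofRowLens]
  simp only [card_column, rowLens_column, rowLen_zero_column hl]
  obtain ⟨i, j⟩ := c
  cases i with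
  | zero => simp
  | succ i => simp

theorem card_hook {l : ℕ} (hl : 1 ≤ l) {n : ℕ} (h : l + 1 ≤ n) : (hook l n).card = n := by
  have : (hook l n).cells = {0} ×ˢ range (n - l) ∪ Icc 1 l ×ˢ {0} := by
    ext ⟨i, j⟩
    rw [YoungDiagram.mem_cells, mem_hook hl]
    simp only [mem_union, mem_product, mem_singleton, mem_range, mem_Icc]
    rw [max_eq_left (by omega), and_assoc]
  rw [YoungDiagram.card, this, card_union_of_disjoint, card_product, card_product]
  · simp
    omega
  · rw [disjoint_left]
    rintro ⟨i, j⟩ h1 h2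
    simp only [mem_product, mem_singleton, mem_range, mem_Icc] at h1 h2
    omega

theorem rowLens_transpose_hook {l : ℕ} (hl : 1 ≤ l) (n : ℕ) :
    (hook l n).transpose.rowLens = (l + 1) :: List.replicate (max (n - l) 1 - 1) 1 := by
  have hs : ((l + 1) :: List.replicate (max (n - l) 1 - 1) 1).SortedGE := by
    rw [List.sortedGE_iff_pairwise, List.pairwise_cons]
    exact ⟨fun x hx => by rw [List.eq_of_mem_replicate hx]; omega,
      List.pairwise_replicate_of_refl⟩
  have : (hook l n).transpose = YoungDiagram.ofRowLens _ hs := by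
    ext ⟨i, j⟩
    rw [YoungDiagram.mem_cells, YoungDiagram.mem_cells, YoungDiagram.mem_transpose, mem_hook hl,
      YoungDiagram.mem_ofRowLens]
    cases i with
    | zero => simp; omega
    | succ i => simp; omega
  rw [this, YoungDiagram.rowLens_ofRowLens_eq_self]
  intro x hx
  rcases List.mem_cons.1 hx with rfl | hx
  · omega
  · simp [List.eq_of_mem_replicate hx]

end Hook

/-! ### Alternating sums over words -/

theorem comp_swap_of_eq {ι A : Type*} [DecidableEq ι] {c : ι → A} {i j : ι} (h : c i = c j) : c ∘ Equiv.swap i j = c := by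
  ext1 k
  rw [Function.comp_apply, Equiv.swap_apply_def]
  split_ifs with h1 h1
  · rw [h1, h]
  · rw [h1, h]
  · rfl

theorem exists_ne_of_not_injective {ι A : Type*} {c : ι → A} (hc : ¬ Function.Injective c) :
    ∃ i j, c i = c j ∧ i ≠ j := by
  simpa [Function.Injective] using hc

section Alternating

variable {ι A M : Type*} [Fintype ι] [DecidableEq ι] [AddCommGroup M] [Module ℂ M]

theorem sum_sign_smul_comp_perm (F : (ι → A) → M) (c : ι → A) (π : Equiv.Perm ι) :
    ∑ σ : Equiv.Perm ι, ((Equiv.Perm.sign σ : ℤ) : ℂ) • F ((c ∘ π) ∘ σ) =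
      ((Equiv.Perm.sign π : ℤ) : ℂ) •
        ∑ σ : Equiv.Perm ι, ((Equiv.Perm.sign σ : ℤ) : ℂ) • F (c ∘ σ) := by
  rw [smul_sum]
  refine Fintype.sum_equiv (Equiv.mulLeft π) _ _ fun σ => ?_
  rw [smul_smul, Equiv.coe_mulLeft, Equiv.Perm.sign_mul, Equiv.Perm.coe_mul, Function.comp_assoc]
  congr 1
  rcases Int.units_eq_one_or (Equiv.Perm.sign π) with h | h <;> simp [h]

theorem eq_zero_of_eq_neg_self {x : M} (h : x = -x) : x = 0 := by
  have h2 : (2 : ℂ) • x = 0 := by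
    rw [two_smul]
    nth_rewrite 2 [h]
    exact add_neg_cancel x
  exact (smul_eq_zero.1 h2).resolve_left two_ne_zero

/-- An alternating sum vanishes if its terms are invariant under a transposition. -/
theorem sum_sign_smul_eq_zero_of_swap (G : Equiv.Perm ι → M) {i j : ι} (hij : i ≠ j)
    (h : ∀ σ, G (σ * Equiv.swap i j) = G σ) :
    ∑ σ : Equiv.Perm ι, ((Equiv.Perm.sign σ : ℤ) : ℂ) • G σ = 0 := by
  apply eq_zero_of_eq_neg_self
  rw [← sum_neg_distrib]
  refine Fintype.sum_equiv (Equiv.mulRight (Equiv.swap i j)) _ _ fun σ => ?_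
  rw [Equiv.coe_mulRight, h, Equiv.Perm.sign_mul, Equiv.Perm.sign_swap hij]
  simp

theorem sum_sign_smul_eq_zero (F : (ι → A) → M) {c : ι → A} (hc : ¬ Function.Injective c) :
    ∑ σ : Equiv.Perm ι, ((Equiv.Perm.sign σ : ℤ) : ℂ) • F (c ∘ σ) = 0 := by
  obtain ⟨i, j, hij, hne⟩ := exists_ne_of_not_injective hc
  have h := sum_sign_smul_comp_perm F c (Equiv.swap i j)
  rw [comp_swap_of_eq hij, Equiv.Perm.sign_swap hne] at h
  exact eq_zero_of_eq_neg_self (by simpa using h)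

end Alternating

/-! ### Column words -/

section Tuples

variable {l n : ℕ}

/-- The tabloid of a hook whose rows of index `1, …, l` hold the entries `c 1, …, c l`. -/
def hookTabloid (c : Fin (l + 1) → Fin n) : Fin n → ℕ :=
  fun k => ∑ i, if c i = k then (i : ℕ) else 0

/-- The polytabloid of a hook whose first column is `c`. It is zero if `c` is not injective, see
`hookPoly_eq_zero`. -/
noncomputable def hookPoly (c : Fin (l + 1) → Fin n) : TabloidSpace n :=
  ∑ σ : Equiv.Perm (Fin (l + 1)),
    ((Equiv.Perm.sign σ : ℤ) : ℂ) • Pi.single (hookTabloid (c ∘ σ)) 1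

/-- Extension of a permutation of the positions in the injective word `c` to a permutation of the
entries. -/
noncomputable def liftPerm {c : Fin (l + 1) → Fin n} (hc : Function.Injective c) :
    Equiv.Perm (Fin (l + 1)) →* Equiv.Perm (Fin n) :=
  Equiv.Perm.extendDomainHom (Equiv.ofInjective c hc)

theorem liftPerm_apply {c : Fin (l + 1) → Fin n} (hc : Function.Injective c)
    (π : Equiv.Perm (Fin (l + 1))) (i : Fin (l + 1)) : liftPerm hc π (c i) = c (π i) :=
  Equiv.Perm.extendDomain_apply_image π (Equiv.ofInjective c hc) i

theorem liftPerm_apply_of_notMem {c : Fin (l + 1) → Fin n} (hc : Function.Injective c)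
    (π : Equiv.Perm (Fin (l + 1))) {k : Fin n} (hk : k ∉ Set.range c) : liftPerm hc π k = k :=
  Equiv.Perm.extendDomain_apply_not_subtype π (Equiv.ofInjective c hc) hk

theorem liftPerm_comp {c : Fin (l + 1) → Fin n} (hc : Function.Injective c)
    (π : Equiv.Perm (Fin (l + 1))) : liftPerm hc π ∘ c = c ∘ π :=
  funext (liftPerm_apply hc π)

theorem sign_liftPerm {c : Fin (l + 1) → Fin n} (hc : Function.Injective c)
    (π : Equiv.Perm (Fin (l + 1))) : Equiv.Perm.sign (liftPerm hc π) = Equiv.Perm.sign π :=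
  Equiv.Perm.sign_extendDomain π (Equiv.ofInjective c hc)

theorem liftPerm_swap {c : Fin (l + 1) → Fin n} (hc : Function.Injective c) (i j : Fin (l + 1)) :
    liftPerm hc (Equiv.swap i j) = Equiv.swap (c i) (c j) := by
  ext1 k
  by_cases hk : k ∈ Set.range c
  · obtain ⟨m, rfl⟩ := hk
    rw [liftPerm_apply, hc.swap_apply]
  · rw [liftPerm_apply_of_notMem hc _ hk, Equiv.swap_apply_of_ne_of_ne]
    · rintro rfl; exact hk ⟨i, rfl⟩
    · rintro rfl; exact hk ⟨j, rfl⟩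

theorem hookTabloid_comp_symm (c : Fin (l + 1) → Fin n) (σ : Equiv.Perm (Fin n)) :
    hookTabloid c ∘ σ.symm = hookTabloid (σ ∘ c) := by
  ext k
  simp only [hookTabloid, Function.comp_apply, Equiv.eq_symm_apply]

theorem hookTabloid_comp (c : Fin (l + 1) → Fin n) (σ : Equiv.Perm (Fin n)) :
    hookTabloid c ∘ σ = hookTabloid (σ.symm ∘ c) := hookTabloid_comp_symm c σ.symm

theorem hookTabloid_apply {c : Fin (l + 1) → Fin n} (hc : Function.Injective c)
    (i : Fin (l + 1)) : hookTabloid c (c i) = i := by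
  rw [hookTabloid, sum_eq_single i]
  · simp
  · intro j _ hj
    rw [if_neg fun h => hj (hc h)]
  · simp

theorem hookTabloid_apply_of_notMem {c : Fin (l + 1) → Fin n} {k : Fin n}
    (hk : k ∉ Set.range c) : hookTabloid c k = 0 :=
  sum_eq_zero fun i _ => if_neg fun h => hk ⟨i, h⟩

theorem hookPoly_eq_zero {c : Fin (l + 1) → Fin n} (hc : ¬ Function.Injective c) :
    hookPoly c = 0 :=
  sum_sign_smul_eq_zero (fun c => Pi.single (hookTabloid c) 1) hc

theorem permAct_single (σ : Equiv.Perm (Fin n)) (r : Fin n → ℕ) (a : ℂ) :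
    permAct σ (Pi.single r a) = Pi.single (r ∘ σ.symm) a := by
  ext s
  rw [permAct, LinearMap.funLeft_apply, Pi.single_apply, Pi.single_apply]
  congr 1
  rw [Equiv.eq_comp_symm]

theorem permAct_hookPoly (σ : Equiv.Perm (Fin n)) (c : Fin (l + 1) → Fin n) :
    permAct σ (hookPoly c) = hookPoly (σ ∘ c) := by
  rw [hookPoly, map_sum, hookPoly]
  refine sum_congr rfl fun π _ => ?_
  rw [map_smul, permAct_single, hookTabloid_comp_symm, Function.comp_assoc]

end Tuples

/-! ### The Specht module of a hook -/

section SpechtHook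

variable {l n : ℕ}

/-- The first column of a tableau of hook shape. -/
def firstColumn (hl : 1 ≤ l) (T : Tableau (hook l n) n) (i : Fin (l + 1)) : Fin n :=
  T ⟨((i : ℕ), 0), by
    rw [YoungDiagram.mem_cells, mem_hook hl]
    have := i.2
    rcases Nat.eq_zero_or_pos (i : ℕ) with h | h
    · exact Or.inl ⟨h, by simp⟩
    · exact Or.inr ⟨h, by omega, rfl⟩⟩

theorem firstColumn_injective (hl : 1 ≤ l) (T : Tableau (hook l n) n) :
    Function.Injective (firstColumn hl T) := by
  intro i j h
  have := T.injective h
  simp only [Subtype.mk.injEq, Prod.mk.injEq, and_true] at this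
  exact Fin.ext this

theorem firstColumn_eq_iff (hl : 1 ≤ l) (T : Tableau (hook l n) n) (i : Fin (l + 1)) (k : Fin n) :
    firstColumn hl T i = k ↔ (T.symm k).1 = ((i : ℕ), 0) := by
  rw [firstColumn, ← Equiv.eq_symm_apply, eq_comm, Subtype.ext_iff]

theorem mem_range_firstColumn (hl : 1 ≤ l) (T : Tableau (hook l n) n) (k : Fin n) :
    k ∈ Set.range (firstColumn hl T) ↔ (T.symm k).1.2 = 0 := by
  have hmem := (T.symm k).2
  rw [YoungDiagram.mem_cells, mem_hook hl] at hmem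
  constructor
  · rintro ⟨i, hi⟩
    rw [(firstColumn_eq_iff hl T i k).1 hi]
  · intro h
    refine ⟨⟨(T.symm k).1.1, by omega⟩, (firstColumn_eq_iff hl T _ k).2 ?_⟩
    rw [← h]

theorem tabloid_eq_hookTabloid (hl : 1 ≤ l) (T : Tableau (hook l n) n) :
    tabloid T = hookTabloid (firstColumn hl T) := by
  ext k
  by_cases hk : k ∈ Set.range (firstColumn hl T)
  · obtain ⟨i, rfl⟩ := hk
    rw [hookTabloid_apply (firstColumn_injective hl T), tabloid,
      (firstColumn_eq_iff hl T i _).1 rfl]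
  · rw [hookTabloid_apply_of_notMem hk, tabloid]
    rw [mem_range_firstColumn] at hk
    have hmem := (T.symm k).2
    rw [YoungDiagram.mem_cells, mem_hook hl] at hmem
    omega

theorem firstColumn_trans (hl : 1 ≤ l) (T : Tableau (hook l n) n) (σ : Equiv.Perm (Fin n)) :
    firstColumn hl (T.trans σ) = σ ∘ firstColumn hl T := rfl

/-- Every column of a hook except the first has a single cell, so the column stabilizer is the
symmetric group of the first column. -/
theorem polytabloid_eq_hookPoly (hl : 1 ≤ l) (T : Tableau (hook l n) n) :
    polytabloid T = hookPoly (firstColumn hl T) := by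
  obtain ⟨c, hcdef⟩ : ∃ c, c = firstColumn hl T := ⟨_, rfl⟩
  have hc : Function.Injective c := hcdef ▸ firstColumn_injective hl T
  have hr : ∀ k, k ∈ Set.range c ↔ (T.symm k).1.2 = 0 := hcdef ▸ mem_range_firstColumn hl T
  rw [← hcdef]
  rw [polytabloid, hookPoly]
  symm
  refine sum_bij (fun π _ => liftPerm hc π) ?_ ?_ ?_ ?_
  · intro π _
    rw [columnStabilizer, mem_filter]
    refine ⟨mem_univ _, fun k => ?_⟩
    by_cases hk : k ∈ Set.range c
    · have hk' : liftPerm hc π k ∈ Set.range c := by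
        obtain ⟨i, rfl⟩ := hk
        exact ⟨π i, (liftPerm_apply hc π i).symm⟩
      rw [(hr _).1 hk, (hr _).1 hk']
    · rw [liftPerm_apply_of_notMem hc π hk]
  · intro π _ ρ _ h
    ext1 i
    apply hc
    rw [← liftPerm_apply hc, ← liftPerm_apply hc, h]
  · intro σ hσ
    rw [columnStabilizer, mem_filter] at hσ
    have h1 : ∀ i, ∃ j, c j = σ (c i) := by
      intro i
      have : σ (c i) ∈ Set.range c := by
        rw [hr, hσ.2, ← hr]
        exact ⟨i, rfl⟩
      exact this
    choose p hp using h1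
    have hpi : Function.Injective p := by
      intro i j h
      have := congrArg c h
      rw [hp, hp] at this
      exact hc (σ.injective this)
    refine ⟨Equiv.ofBijective p (Finite.injective_iff_bijective.1 hpi), mem_univ _, ?_⟩
    ext1 k
    by_cases hk : k ∈ Set.range c
    · obtain ⟨i, rfl⟩ := hk
      rw [liftPerm_apply, ← hp]
      rfl
    · rw [liftPerm_apply_of_notMem hc _ hk]
      rw [hr] at hk
      have h2 := hσ.2 k
      have m1 := (T.symm k).2
      have m2 := (T.symm (σ k)).2
      rw [YoungDiagram.mem_cells, mem_hook hl] at m1 m2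
      apply T.symm.injective
      apply Subtype.ext
      apply Prod.ext
      · omega
      · exact h2.symm
  · intro π _
    rw [sign_liftPerm, tabloid_eq_hookTabloid hl, firstColumn_trans, ← hcdef, liftPerm_comp]

theorem exists_perm_comp_eq {a b : Fin (l + 1) → Fin n} (ha : Function.Injective a)
    (hb : Function.Injective b) : ∃ σ : Equiv.Perm (Fin n), σ ∘ a = b := by
  classical
  let e : {x // x ∈ Set.range a} ≃ {x // x ∈ Set.range b} :=
    (Equiv.ofInjective a ha).symm.trans (Equiv.ofInjective b hb)
  refine ⟨e.extendSubtype, funext fun i => ?_⟩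
  rw [Function.comp_apply, Equiv.extendSubtype_apply_of_mem e (a i) ⟨i, rfl⟩]
  have : (Equiv.ofInjective a ha).symm ⟨a i, ⟨i, rfl⟩⟩ = i := Equiv.ofInjective_symm_apply ha i
  simp [e, this]

/-- Admitting all words treats every $n$ uniformly. An injective word forces $n\ge l+1$; tableaux
then exist, and any one of them can be relabelled to have that word as its first column. -/
theorem specht_hook (hl : 1 ≤ l) (n : ℕ) :
    specht (hook l n) n = Submodule.span ℂ (Set.range (hookPoly (l := l) (n := n))) := by
  apply le_antisymm
  · rw [specht, Submodule.span_le]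
    rintro _ ⟨T, rfl⟩
    beta_reduce
    rw [polytabloid_eq_hookPoly hl]
    exact Submodule.subset_span ⟨_, rfl⟩
  · rw [Submodule.span_le]
    rintro _ ⟨c, rfl⟩
    by_cases hc : Function.Injective c
    · have hn : l + 1 ≤ n := by simpa using Fintype.card_le_of_injective c hc
      have hcard : Fintype.card {c // c ∈ (hook l n).cells} = n := by
        rw [Fintype.card_coe]
        exact card_hook hl hn
      let T₀ : Tableau (hook l n) n := Fintype.equivFinOfCardEq hcard
      obtain ⟨σ, hσ⟩ := exists_perm_comp_eq (firstColumn_injective hl T₀) hc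
      refine Submodule.subset_span ⟨T₀.trans σ, ?_⟩
      beta_reduce
      rw [polytabloid_eq_hookPoly hl, firstColumn_trans, hσ]
    · rw [hookPoly_eq_zero hc]
      exact Submodule.zero_mem _

end SpechtHook

/-! ### The set partitions of conjugate hook shape -/

section HookPartitions

variable {l n : ℕ}

/-- The sum of the subspaces fixed by the transpositions of two elements of `p`. -/
noncomputable def hyperplaneOf (l : ℕ) {n : ℕ} (p : Finset (Fin n)) : Submodule ℂ (specht (hook l n) n) :=
  ⨆ (i : Fin n) (j : Fin n) (_ : i ≠ j ∧ i ∈ p ∧ j ∈ p), fixedSubspace (hook l n) n (Equiv.swap i j)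

theorem mem_setPartitions_hook (hl : 1 ≤ l) (α : Finpartition (univ : Finset (Fin n))) :
    α ∈ setPartitions (hook l n).transpose n ↔
      ∃ p ∈ α.parts, p.card = l + 1 ∧ ∀ q ∈ α.parts, q ≠ p → q.card = 1 := by
  rw [setPartitions, mem_filter, rowLens_transpose_hook hl, ← Multiset.cons_coe]
  simp only [mem_univ, true_and]
  have herase (p : Finset (Fin n)) (hp : p ∈ α.parts) : α.parts.val.map Finset.card =
      p.card ::ₘ (α.parts.erase p).val.map Finset.card := by
    rw [← Multiset.map_cons, ← insert_val_of_notMem (notMem_erase p _), insert_erase hp]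
  constructor
  · intro h
    have hmem : l + 1 ∈ α.parts.val.map Finset.card := by
      rw [h]
      exact Multiset.mem_cons_self _ _
    obtain ⟨p, hp, hpc⟩ := Multiset.mem_map.1 hmem
    refine ⟨p, hp, hpc, fun q hq hqp => ?_⟩
    rw [herase p hp, hpc, Multiset.cons_inj_right] at h
    have : q.card ∈ (α.parts.erase p).val.map Finset.card :=
      Multiset.mem_map_of_mem _ (mem_erase.2 ⟨hqp, hq⟩)
    rw [h, Multiset.mem_coe] at this
    exact List.eq_of_mem_replicate this
  · rintro ⟨p, hp, hpc, h⟩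
    have hrep : (α.parts.erase p).val.map Finset.card =
        Multiset.replicate (α.parts.erase p).card 1 := by
      rw [Multiset.eq_replicate]
      refine ⟨by rw [Multiset.card_map]; rfl, fun b hb => ?_⟩
      obtain ⟨q, hq, rfl⟩ := Multiset.mem_map.1 hb
      exact h q (mem_erase.1 hq).2 (mem_erase.1 hq).1
    -- The part sizes add up to $n$, which forces the number of singletons.
    have hsum := α.sum_card_parts
    rw [← add_sum_erase _ _ hp, hpc, sum_congr rfl (g := fun _ => 1)
      fun q hq => h q (mem_erase.1 hq).2 (mem_erase.1 hq).1, ← card_eq_sum_ones, card_univ,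
      Fintype.card_fin] at hsum
    rw [herase p hp, hpc, hrep, Multiset.coe_replicate]
    congr 2
    omega

/-- Singletons contain no transposition, so only the large part matters. -/
theorem intrinsicHyperplane_eq (μ : YoungDiagram) {α : Finpartition (univ : Finset (Fin n))}
    {p : Finset (Fin n)} (hp : p ∈ α.parts) (h : ∀ q ∈ α.parts, q ≠ p → q.card = 1) :
    intrinsicHyperplane μ n α = ⨆ (i : Fin n) (j : Fin n) (_ : i ≠ j ∧ i ∈ p ∧ j ∈ p),
      fixedSubspace μ n (Equiv.swap i j) := by
  rw [intrinsicHyperplane]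
  refine iSup_congr fun i => iSup_congr fun j => iSup_congr_Prop ?_ fun _ => rfl
  refine and_congr_right fun hij => ⟨?_, fun h => ⟨p, hp, h⟩⟩
  rintro ⟨q, hq, hi, hj⟩
  by_cases hqp : q = p
  · exact hqp ▸ ⟨hi, hj⟩
  · exact (hij (card_le_one.1 (h q hq hqp).le i hi j hj)).elim

theorem exists_setPartition (hl : 1 ≤ l) {p : Finset (Fin n)} (hp : p.card = l + 1) :
    ∃ α ∈ setPartitions (hook l n).transpose n, p ∈ α.parts ∧
      ∀ q ∈ α.parts, q ≠ p → q.card = 1 := by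
  let α : Finpartition (univ : Finset (Fin n)) :=
    (⊥ : Finpartition pᶜ).extend (b := p) (by
      rw [bot_eq_empty, ← nonempty_iff_ne_empty, ← card_pos]
      omega) disjoint_compl_left (by simp)
  have h1 : p ∈ α.parts := mem_insert_self _ _
  have h2 : ∀ q ∈ α.parts, q ≠ p → q.card = 1 := by
    intro q hq hqp
    obtain ⟨a, -, rfl⟩ := (Finpartition.mem_bot_iff).1 ((mem_insert.1 hq).resolve_left hqp)
    exact card_singleton a
  exact ⟨α, (mem_setPartitions_hook hl α).2 ⟨p, h1, hp, h2⟩, h1, h2⟩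

theorem mem_hookArrangement (hl : 1 ≤ l) {H : Submodule ℂ (specht (hook l n) n)} :
    H ∈ hookArrangement l n ↔ ∃ p : Finset (Fin n), p.card = l + 1 ∧ hyperplaneOf l p = H := by
  classical
  rw [hookArrangement, intrinsicArrangement, mem_image]
  constructor
  · rintro ⟨α, hα, rfl⟩
    obtain ⟨p, hp, hpc, h⟩ := (mem_setPartitions_hook hl α).1 hα
    exact ⟨p, hpc, (intrinsicHyperplane_eq _ hp h).symm⟩
  · rintro ⟨p, hp, rfl⟩
    obtain ⟨α, hα, h1, h2⟩ := exists_setPartition hl hp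
    exact ⟨α, hα, intrinsicHyperplane_eq _ h1 h2⟩

theorem mem_specialFlat (hl : 1 ≤ l) {m : ℕ} {f : Fin n → Fin m} {v : specht (hook l n) n} :
    v ∈ specialFlat l n f ↔ ∀ p : Finset (Fin n), p.card = l + 1 → (p.image f).card < l + 1 →
      v ∈ hyperplaneOf l p := by
  rw [specialFlat, Submodule.mem_finsetInf]
  constructor
  · intro h p hp hf
    obtain ⟨α, hα, h1, h2⟩ := exists_setPartition hl hp
    have := h α (mem_filter.2 ⟨hα, p, h1, hp, hf⟩)
    rwa [intrinsicHyperplane_eq _ h1 h2] at this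
  · intro h α hα
    obtain ⟨hα, q, hq, hqc, hqf⟩ := mem_filter.1 hα
    obtain ⟨p, hp, hpc, hp1⟩ := (mem_setPartitions_hook hl α).1 hα
    have hqp : q = p := by
      by_contra hne
      have := hp1 q hq hne
      omega
    subst hqp
    rw [intrinsicHyperplane_eq _ hp hp1]
    exact h q hqc hqf

theorem specialFlat_mem_flats {m : ℕ} (f : Fin n → Fin m) :
    specialFlat l n f ∈ flats (hookArrangement l n) := by
  classical
  have h : specialFlat l n f = (((setPartitions (hook l n).transpose n).filter fun α =>
      ∃ p ∈ α.parts, p.card = l + 1 ∧ (p.image f).card < l + 1).image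
        (intrinsicHyperplane (hook l n) n)).inf id := by
    rw [inf_image]
    rfl
  rw [h]
  exact inf_mem_flats (image_subset_image (filter_subset _ _))

end HookPartitions

/-! ### The linear forms of the hyperplanes -/

section HookForm

variable {l n : ℕ}

/-- The pairing with the polytabloid `hookPoly c`. -/
noncomputable def hookForm (c : Fin (l + 1) → Fin n) : TabloidSpace n →ₗ[ℂ] ℂ :=
  ∑ σ : Equiv.Perm (Fin (l + 1)),
    ((Equiv.Perm.sign σ : ℤ) : ℂ) • LinearMap.proj (hookTabloid (c ∘ σ))

theorem hookForm_apply (c : Fin (l + 1) → Fin n) (v : TabloidSpace n) :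
    hookForm c v = ∑ σ : Equiv.Perm (Fin (l + 1)),
      ((Equiv.Perm.sign σ : ℤ) : ℂ) • v (hookTabloid (c ∘ σ)) := by
  simp [hookForm, LinearMap.sum_apply]

theorem hookForm_comp_perm (c : Fin (l + 1) → Fin n) (π : Equiv.Perm (Fin (l + 1)))
    (v : TabloidSpace n) :
    hookForm (c ∘ π) v = ((Equiv.Perm.sign π : ℤ) : ℂ) • hookForm c v := by
  rw [hookForm_apply, hookForm_apply]
  exact sum_sign_smul_comp_perm (fun c => v (hookTabloid c)) c π

theorem hookForm_eq_zero {c : Fin (l + 1) → Fin n} (hc : ¬ Function.Injective c)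
    (v : TabloidSpace n) : hookForm c v = 0 := by
  rw [hookForm_apply]
  exact sum_sign_smul_eq_zero (fun c => v (hookTabloid c)) hc

theorem hookForm_permAct (c : Fin (l + 1) → Fin n) (σ : Equiv.Perm (Fin n))
    (v : TabloidSpace n) : hookForm c (permAct σ v) = hookForm (σ.symm ∘ c) v := by
  rw [hookForm_apply, hookForm_apply]
  refine sum_congr rfl fun π _ => ?_
  rw [permAct, LinearMap.funLeft_apply, hookTabloid_comp, Function.comp_assoc]

theorem hookForm_eq_zero_of_permAct_swap {c : Fin (l + 1) → Fin n} {i j : Fin (l + 1)}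
    (hij : i ≠ j) {v : TabloidSpace n} (hv : permAct (Equiv.swap (c i) (c j)) v = v) :
    hookForm c v = 0 := by
  by_cases hc : Function.Injective c
  · apply eq_zero_of_eq_neg_self
    have h := hookForm_permAct c (Equiv.swap (c i) (c j)) v
    rw [hv, Equiv.symm_swap, ← liftPerm_swap hc, liftPerm_comp, hookForm_comp_perm,
      Equiv.Perm.sign_swap hij] at h
    simpa using h
  · exact hookForm_eq_zero hc v

/-- Row 0 is also the default row, so a tabloid does not see the entry in position 0. This is what
makes the boundary relation work. -/
theorem hookTabloid_update_zero (c : Fin (l + 1) → Fin n) (b : Fin n) :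
    hookTabloid (Function.update c 0 b) = hookTabloid c := by
  ext k
  refine sum_congr rfl fun i _ => ?_
  by_cases hi : i = 0
  · subst hi
    simp
  · rw [Function.update_of_ne hi]

theorem hookTabloid_congr {c d : Fin (l + 1) → Fin n} (h : ∀ i, i ≠ 0 → c i = d i) :
    hookTabloid c = hookTabloid d := by
  rw [← hookTabloid_update_zero d (c 0)]
  congr 1
  ext1 i
  by_cases hi : i = 0
  · subst hi
    simp
  · rw [Function.update_of_ne hi, h i hi]

/-- The boundary relation of the `l + 2` entries of `c` and `b`. -/
theorem sum_hookForm_update (c : Fin (l + 1) → Fin n) (b : Fin n) (v : TabloidSpace n) :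
    ∑ i, hookForm (Function.update c i b) v = hookForm c v := by
  have h1 : ∀ i, hookForm (Function.update c i b) v = ∑ σ : Equiv.Perm (Fin (l + 1)),
      ((Equiv.Perm.sign σ : ℤ) : ℂ) •
        v (hookTabloid (Function.update (c ∘ σ) (σ.symm i) b)) := by
    intro i
    rw [hookForm_apply]
    refine sum_congr rfl fun σ _ => ?_
    congr 3
    exact (Function.update_comp_equiv c σ i b)
  have h2 : ∀ σ : Equiv.Perm (Fin (l + 1)), ∑ i, ((Equiv.Perm.sign σ : ℤ) : ℂ) •
      v (hookTabloid (Function.update (c ∘ σ) (σ.symm i) b)) =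
      ∑ j, ((Equiv.Perm.sign σ : ℤ) : ℂ) • v (hookTabloid (Function.update (c ∘ σ) j b)) :=
    fun σ => Equiv.sum_comp σ.symm fun j => ((Equiv.Perm.sign σ : ℤ) : ℂ) •
      v (hookTabloid (Function.update (c ∘ σ) j b))
  -- For fixed `σ` the sum over replaced entries becomes a sum over positions `j`. For `j = 0` the
  -- new entry is invisible and the term is `hookForm c v`; the other positions contribute zero.
  rw [sum_congr rfl fun i _ => h1 i, sum_comm, sum_congr rfl fun σ _ => h2 σ, sum_comm,
    sum_eq_single 0, hookForm_apply]
  · exact sum_congr rfl fun σ _ => by rw [hookTabloid_update_zero]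
  · intro j _ hj
    -- Swapping positions `j` and 0 moves only the entry overwritten by `b` and the invisible entry
    -- in position 0, so the tabloid is unchanged and the terms cancel in pairs.
    refine sum_sign_smul_eq_zero_of_swap
      (fun σ => v (hookTabloid (Function.update (c ∘ σ) j b))) hj fun σ => ?_
    congr 1
    refine hookTabloid_congr fun i hi => ?_
    by_cases hij : i = j
    · subst hij
      simp
    · rw [Function.update_of_ne hij, Function.update_of_ne hij, Function.comp_apply,
        Function.comp_apply, Equiv.Perm.mul_apply, Equiv.swap_apply_of_ne_of_ne hij hi]
  · simp

end HookForm

/-! ### The pairing on the Specht module -/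

section Pairing

variable {l n : ℕ}

theorem permAct_mem_specht (hl : 1 ≤ l) (σ : Equiv.Perm (Fin n)) :
    ∀ v ∈ specht (hook l n) n, permAct σ v ∈ specht (hook l n) n := by
  rw [specht_hook hl]
  intro v hv
  have : Submodule.span ℂ (Set.range (hookPoly (l := l) (n := n))) ≤
      (Submodule.span ℂ (Set.range (hookPoly (l := l) (n := n)))).comap (permAct σ) := by
    rw [Submodule.span_le]
    rintro _ ⟨c, rfl⟩
    rw [SetLike.mem_coe, Submodule.mem_comap, permAct_hookPoly]
    exact Submodule.subset_span ⟨_, rfl⟩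
  exact this hv

theorem hookPoly_mem_specht (hl : 1 ≤ l) (c : Fin (l + 1) → Fin n) :
    hookPoly c ∈ specht (hook l n) n := by
  rw [specht_hook hl]
  exact Submodule.subset_span ⟨c, rfl⟩

theorem hookPoly_apply (c : Fin (l + 1) → Fin n) (r : Fin n → ℕ) :
    hookPoly c r = ∑ σ : Equiv.Perm (Fin (l + 1)),
      if hookTabloid (c ∘ σ) = r then ((Equiv.Perm.sign σ : ℤ) : ℂ) else 0 := by
  rw [hookPoly, Finset.sum_apply]
  refine sum_congr rfl fun σ _ => ?_
  rw [Pi.smul_apply, Pi.single_apply, smul_eq_mul, mul_ite, mul_one, mul_zero]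
  simp only [eq_comm]

/-- The elements of the Specht module vanish outside the tabloids of hook shape. -/
theorem apply_eq_zero_of_mem_specht (hl : 1 ≤ l) {v : TabloidSpace n}
    (hv : v ∈ specht (hook l n) n) {r : Fin n → ℕ}
    (hr : ∀ c : Fin (l + 1) → Fin n, Function.Injective c → hookTabloid c ≠ r) : v r = 0 := by
  rw [specht_hook hl] at hv
  induction hv using Submodule.span_induction with
  | mem x hx =>
    obtain ⟨c, rfl⟩ := hx
    by_cases hc : Function.Injective c
    · rw [hookPoly_apply]
      exact sum_eq_zero fun σ _ => if_neg (hr _ (hc.comp σ.injective))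
    · rw [hookPoly_eq_zero hc]
      rfl
  | zero => rfl
  | add x y _ _ hx hy => rw [Pi.add_apply, hx, hy, add_zero]
  | smul a x _ hx => rw [Pi.smul_apply, hx, smul_zero]

/-- Positivity of the Hermitian form: if $v=\sum_c a_c e_c$ then $\langle v,v\rangle=\sum_c \bar
a_c\,\langle v,e_c\rangle=0$, because the polytabloids have real coordinates. -/
theorem eq_zero_of_forall_hookForm_eq_zero (hl : 1 ≤ l) {v : TabloidSpace n}
    (hv : v ∈ specht (hook l n) n)
    (h : ∀ c : Fin (l + 1) → Fin n, hookForm c v = 0) : v = 0 := by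
  have hv' := hv
  rw [specht_hook hl, Submodule.mem_span_range_iff_exists_fun] at hv'
  obtain ⟨a, ha⟩ := hv'
  -- The ambient space has infinitely many coordinates; those of `v` outside this finite set vanish.
  let R : Finset (Fin n → ℕ) := univ.image (hookTabloid (l := l) (n := n))
  have hconj (r : Fin n → ℕ) : (starRingEnd ℂ) (v r) =
      ∑ c, ∑ σ : Equiv.Perm (Fin (l + 1)), (starRingEnd ℂ) (a c) *
        if hookTabloid (c ∘ σ) = r then ((Equiv.Perm.sign σ : ℤ) : ℂ) else 0 := by
    rw [← ha, Finset.sum_apply, map_sum]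
    refine sum_congr rfl fun c _ => ?_
    rw [Pi.smul_apply, smul_eq_mul, map_mul, hookPoly_apply, map_sum, mul_sum]
    refine sum_congr rfl fun σ _ => ?_
    rw [apply_ite (starRingEnd ℂ), map_zero]
    simp
  have hsum : ∑ r ∈ R, v r * (starRingEnd ℂ) (v r) = 0 := by
    simp only [hconj, mul_sum]
    rw [sum_comm]
    refine sum_eq_zero fun c _ => ?_
    rw [sum_comm]
    calc ∑ σ : Equiv.Perm (Fin (l + 1)), ∑ r ∈ R, v r * ((starRingEnd ℂ) (a c) *
          if hookTabloid (c ∘ σ) = r then ((Equiv.Perm.sign σ : ℤ) : ℂ) else 0)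
        = ∑ σ : Equiv.Perm (Fin (l + 1)), (starRingEnd ℂ) (a c) *
          (((Equiv.Perm.sign σ : ℤ) : ℂ) • v (hookTabloid (c ∘ σ))) := by
          refine sum_congr rfl fun σ _ => ?_
          rw [sum_eq_single (hookTabloid (c ∘ σ)), if_pos rfl, smul_eq_mul]
          · ring
          · intro r _ hr
            rw [if_neg hr.symm, mul_zero, mul_zero]
          · intro hr
            exact (hr (mem_image_of_mem _ (mem_univ _))).elim
      _ = 0 := by rw [← mul_sum, ← hookForm_apply, h c, mul_zero]
  simp only [Complex.mul_conj] at hsum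
  rw [← Complex.ofReal_sum, Complex.ofReal_eq_zero,
    sum_eq_zero_iff_of_nonneg fun r _ => Complex.normSq_nonneg _] at hsum
  ext r
  by_cases hr : r ∈ R
  · exact Complex.normSq_eq_zero.1 (hsum r hr)
  · refine apply_eq_zero_of_mem_specht hl hv fun c _ hc => hr ?_
    rw [← hc]
    exact mem_image_of_mem _ (mem_univ _)

end Pairing

/-! ### The hyperplanes -/

section Hyperplane

variable {l n : ℕ}

/-- The action of a permutation on the Specht module of a hook. -/
noncomputable def spechtAct (hl : 1 ≤ l) (σ : Equiv.Perm (Fin n)) :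
    specht (hook l n) n →ₗ[ℂ] specht (hook l n) n :=
  (permAct σ).restrict (permAct_mem_specht hl σ)

theorem spechtAct_mul (hl : 1 ≤ l) (σ τ : Equiv.Perm (Fin n)) (v : specht (hook l n) n) :
    spechtAct hl (σ * τ) v = spechtAct hl σ (spechtAct hl τ v) := rfl

theorem spechtAct_one (hl : 1 ≤ l) (v : specht (hook l n) n) : spechtAct hl 1 v = v := rfl

theorem coe_spechtAct_apply (hl : 1 ≤ l) (σ : Equiv.Perm (Fin n)) (v : specht (hook l n) n)
    (r : Fin n → ℕ) : (spechtAct hl σ v : TabloidSpace n) r = v.1 (r ∘ σ) := rfl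

theorem mem_fixedSubspace (hl : 1 ≤ l) {σ : Equiv.Perm (Fin n)} {v : specht (hook l n) n} :
    v ∈ fixedSubspace (hook l n) n σ ↔ spechtAct hl σ v = v := by
  rw [Subtype.ext_iff]
  rfl

theorem fixedSubspace_le_hyperplaneOf {p : Finset (Fin n)} {i j : Fin n} (hij : i ≠ j)
    (hi : i ∈ p) (hj : j ∈ p) :
    fixedSubspace (hook l n) n (Equiv.swap i j) ≤ hyperplaneOf l p :=
  le_iSup_of_le i (le_iSup_of_le j (le_iSup_of_le ⟨hij, hi, hj⟩ le_rfl))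

/-- Write the permutation as a product of transpositions and telescope: each step adds a vector
$u+\tau u$, which is fixed by $\tau$. -/
theorem sub_sign_smul_mem_hyperplaneOf (hl : 1 ≤ l) {c : Fin (l + 1) → Fin n}
    (hc : Function.Injective c) (σ : Equiv.Perm (Fin (l + 1))) (v : specht (hook l n) n) :
    v - ((Equiv.Perm.sign σ : ℤ) : ℂ) • spechtAct hl (liftPerm hc σ) v ∈
      hyperplaneOf l (univ.image c) := by
  induction σ using Equiv.Perm.swap_induction_on with
  | one => simp [spechtAct_one]
  | swap_mul σ x y hxy ih =>
    set u := ((Equiv.Perm.sign σ : ℤ) : ℂ) • spechtAct hl (liftPerm hc σ) v with hu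
    set τ := Equiv.swap (c x) (c y) with hτ
    have h1 : ((Equiv.Perm.sign (Equiv.swap x y * σ) : ℤ) : ℂ) •
        spechtAct hl (liftPerm hc (Equiv.swap x y * σ)) v = -spechtAct hl τ u := by
      rw [(liftPerm hc).map_mul, spechtAct_mul, liftPerm_swap, Equiv.Perm.sign_mul, Equiv.Perm.sign_swap hxy,
        hu, map_smul, hτ]
      simp only [neg_mul, one_mul, Units.val_neg, Int.cast_neg]
      exact neg_smul ((Equiv.Perm.sign σ : ℤ) : ℂ)
        (spechtAct hl (Equiv.swap (c x) (c y)) (spechtAct hl (liftPerm hc σ) v))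
    have h2 : u + spechtAct hl τ u ∈ hyperplaneOf l (univ.image c) := by
      refine fixedSubspace_le_hyperplaneOf (hc.ne hxy) (mem_image_of_mem _ (mem_univ _))
        (mem_image_of_mem _ (mem_univ _)) ((mem_fixedSubspace hl).2 ?_)
      rw [map_add, ← spechtAct_mul, Equiv.swap_mul_self, spechtAct_one, add_comm]
    rw [h1, sub_neg_eq_add]
    have := Submodule.add_mem _ ih h2
    rwa [← add_assoc, sub_add_cancel] at this

/-- If the entries of `c` lie in distinct rows, they occupy all $l+1$ rows. The rows of positive
index have one entry each, so they are filled by entries of `c`. -/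
theorem eq_hookTabloid_of_injective {c d : Fin (l + 1) → Fin n} (hd : Function.Injective d)
    (h : Function.Injective (hookTabloid d ∘ c)) :
    ∃ ρ : Equiv.Perm (Fin (l + 1)), hookTabloid d = hookTabloid (c ∘ ρ) := by
  have hc : Function.Injective c := h.of_comp
  have hlt : ∀ k, hookTabloid d k < l + 1 := by
    intro k
    by_cases hk : k ∈ Set.range d
    · obtain ⟨i, rfl⟩ := hk
      rw [hookTabloid_apply hd]
      exact i.2
    · rw [hookTabloid_apply_of_notMem hk]
      omega
  let p : Fin (l + 1) → Fin (l + 1) := fun i => ⟨hookTabloid d (c i), hlt _⟩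
  have hp : Function.Injective p := fun i j hij => h (by simpa [p] using hij)
  let e := Equiv.ofBijective p (Finite.injective_iff_bijective.1 hp)
  have he (i : Fin (l + 1)) : hookTabloid d (c (e.symm i)) = i :=
    congrArg Fin.val (e.apply_symm_apply i)
  have hinj : Function.Injective (c ∘ e.symm) := hc.comp e.symm.injective
  refine ⟨e.symm, funext fun k => ?_⟩
  by_cases hk : k ∈ Set.range (c ∘ e.symm)
  · obtain ⟨i, rfl⟩ := hk
    rw [hookTabloid_apply hinj, Function.comp_apply, he]
  · rw [hookTabloid_apply_of_notMem hk]
    by_cases hk' : k ∈ Set.range d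
    · obtain ⟨j, rfl⟩ := hk'
      rw [hookTabloid_apply hd]
      by_contra hj
      have h2 : c (e.symm j) ∈ Set.range d := by
        by_contra hcon
        have := he j
        rw [hookTabloid_apply_of_notMem hcon] at this
        exact hj this.symm
      obtain ⟨m, hm⟩ := h2
      have h3 := he j
      rw [← hm, hookTabloid_apply hd] at h3
      have h4 : m = j := Fin.ext h3
      exact hk ⟨j, by rw [Function.comp_apply, ← hm, h4]⟩
    · exact hookTabloid_apply_of_notMem hk'

/-- Evaluate at a hook tabloid. If its rows separate the entries of `c`, the value is plus or minus
the pairing of `v` with the polytabloid; if two entries share a row, their transposition fixes the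
tabloid and the terms cancel. -/
theorem sum_sign_smul_spechtAct_eq_zero (hl : 1 ≤ l) {c : Fin (l + 1) → Fin n}
    (hc : Function.Injective c) {v : specht (hook l n) n} (hv : hookForm c v.1 = 0) :
    ∑ σ : Equiv.Perm (Fin (l + 1)),
      ((Equiv.Perm.sign σ : ℤ) : ℂ) • spechtAct hl (liftPerm hc σ) v = 0 := by
  apply Subtype.ext
  ext r
  rw [Submodule.coe_sum, Finset.sum_apply, ZeroMemClass.coe_zero, Pi.zero_apply]
  simp only [Submodule.coe_smul, Pi.smul_apply, coe_spechtAct_apply]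
  by_cases hr : ∃ d : Fin (l + 1) → Fin n, Function.Injective d ∧ hookTabloid d = r
  · obtain ⟨d, hd, rfl⟩ := hr
    by_cases hi : Function.Injective (hookTabloid d ∘ c)
    · obtain ⟨ρ, hρ⟩ := eq_hookTabloid_of_injective hd hi
      have h1 : ∀ σ : Equiv.Perm (Fin (l + 1)), hookTabloid d ∘ liftPerm hc σ =
          hookTabloid (c ∘ (σ⁻¹ * ρ)) := by
        intro σ
        rw [hρ, hookTabloid_comp, ← Function.comp_assoc,
          show (liftPerm hc σ).symm = liftPerm hc σ⁻¹ from (map_inv (liftPerm hc) σ).symm,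
          liftPerm_comp]
        rfl
      have h2 : ∑ σ : Equiv.Perm (Fin (l + 1)), ((Equiv.Perm.sign σ : ℤ) : ℂ) •
          v.1 (hookTabloid d ∘ liftPerm hc σ) =
          ((Equiv.Perm.sign ρ : ℤ) : ℂ) • hookForm c v.1 := by
        rw [hookForm_apply, smul_sum]
        refine Fintype.sum_equiv ((Equiv.inv _).trans (Equiv.mulRight ρ)) _ _ fun σ => ?_
        rw [h1, Equiv.trans_apply, Equiv.inv_apply, Equiv.coe_mulRight, smul_smul,
          Equiv.Perm.sign_mul, Equiv.Perm.sign_inv]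
        congr 1
        rcases Int.units_eq_one_or (Equiv.Perm.sign ρ) with h | h <;> simp [h]
      rw [h2, hv, smul_zero]
    · obtain ⟨i, j, hij, hne⟩ := exists_ne_of_not_injective hi
      have hswap : hookTabloid d ∘ Equiv.swap (c i) (c j) = hookTabloid d := comp_swap_of_eq hij
      -- Inversion turns right multiplication by the transposition into left multiplication, where
      -- it meets the tabloid.
      rw [← Equiv.sum_comp (Equiv.inv _)]
      simp only [Equiv.inv_apply, Equiv.Perm.sign_inv]
      refine sum_sign_smul_eq_zero_of_swap
        (fun σ => v.1 (hookTabloid d ∘ liftPerm hc σ⁻¹)) hne fun σ => ?_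
      rw [mul_inv_rev, Equiv.swap_inv, map_mul, Equiv.Perm.coe_mul, ← Function.comp_assoc,
        liftPerm_swap, hswap]
  · refine sum_eq_zero fun σ _ => ?_
    rw [apply_eq_zero_of_mem_specht hl v.2, smul_zero]
    intro d hd hcon
    refine hr ⟨liftPerm hc σ ∘ d, (liftPerm hc σ).injective.comp hd, ?_⟩
    rw [← hookTabloid_comp_symm, hcon, Function.comp_assoc, Equiv.self_comp_symm,
      Function.comp_id]

/-- The sum of the fixed spaces is the hyperplane orthogonal to a polytabloid. -/
theorem mem_hyperplaneOf_image (hl : 1 ≤ l) {c : Fin (l + 1) → Fin n}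
    (hc : Function.Injective c) {v : specht (hook l n) n} :
    v ∈ hyperplaneOf l (univ.image c) ↔ hookForm c v.1 = 0 := by
  constructor
  · intro hv
    have : hyperplaneOf l (univ.image c) ≤
        LinearMap.ker (hookForm c ∘ₗ (specht (hook l n) n).subtype) := by
      refine iSup_le fun a => iSup_le fun b => iSup_le fun ⟨hab, ha, hb⟩ => fun w hw => ?_
      obtain ⟨i, -, rfl⟩ := mem_image.1 ha
      obtain ⟨j, -, rfl⟩ := mem_image.1 hb
      rw [LinearMap.mem_ker]
      exact hookForm_eq_zero_of_permAct_swap (fun h => hab (congrArg c h)) hw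
    exact this hv
  · intro hv
    have h1 : ∑ σ : Equiv.Perm (Fin (l + 1)),
        (v - ((Equiv.Perm.sign σ : ℤ) : ℂ) • spechtAct hl (liftPerm hc σ) v) ∈
        hyperplaneOf l (univ.image c) :=
      Submodule.sum_mem _ fun σ _ => sub_sign_smul_mem_hyperplaneOf hl hc σ v
    rw [sum_sub_distrib, sum_sign_smul_spechtAct_eq_zero hl hc hv, sub_zero, sum_const,
      ← Nat.cast_smul_eq_nsmul ℂ] at h1
    refine (Submodule.smul_mem_iff _ ?_).1 h1
    rw [Nat.cast_ne_zero, ← pos_iff_ne_zero, card_pos]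
    exact univ_nonempty

theorem exists_injective_image_eq {p : Finset (Fin n)} (hp : p.card = l + 1) :
    ∃ c : Fin (l + 1) → Fin n, Function.Injective c ∧ univ.image c = p :=
  ⟨p.orderEmbOfFin hp, (p.orderEmbOfFin hp).injective, by simp⟩

end Hyperplane

/-! ### Special flats -/

section SpecialFlat

variable {l n : ℕ}

theorem mem_specialFlat_iff (hl : 1 ≤ l) {f : Fin n → Fin (l + 1)} {v : specht (hook l n) n} :
    v ∈ specialFlat l n f ↔
      ∀ c : Fin (l + 1) → Fin n, ¬ Function.Injective (f ∘ c) → hookForm c v.1 = 0 := by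
  rw [mem_specialFlat hl]
  constructor
  · intro h c hf
    by_cases hc : Function.Injective c
    · rw [← mem_hyperplaneOf_image hl hc]
      have hcard : (univ.image c).card = l + 1 := by
        rw [card_image_of_injective _ hc, card_univ, Fintype.card_fin]
      refine h _ hcard (lt_of_le_of_ne (card_image_le.trans hcard.le) fun h' => hf ?_)
      rw [image_image] at h'
      replace h' := card_image_iff.1 (h'.trans (card_fin (l + 1)).symm)
      exact fun i j hij => h' (mem_coe.2 (mem_univ i)) (mem_coe.2 (mem_univ j)) hij
    · exact hookForm_eq_zero hc _
  · intro h p hp hf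
    obtain ⟨c, hc, rfl⟩ := exists_injective_image_eq hp
    rw [mem_hyperplaneOf_image hl hc]
    refine h c fun hinj => ?_
    rw [image_image, card_image_of_injective _ hinj, card_univ, Fintype.card_fin] at hf
    exact lt_irrefl _ hf

/-- In the boundary relation of `c` and `b`, replacing any entry other than `c (f b)` leaves this
entry and `b` in one fibre, so that term vanishes. -/
theorem hookForm_update_eq {f : Fin n → Fin (l + 1)} {v : TabloidSpace n}
    (hv : ∀ c : Fin (l + 1) → Fin n, ¬ Function.Injective (f ∘ c) → hookForm c v = 0)
    {c : Fin (l + 1) → Fin n} (hc : ∀ i, f (c i) = i) (b : Fin n) :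
    hookForm (Function.update c (f b) b) v = hookForm c v := by
  rw [← sum_hookForm_update c b v, sum_eq_single (f b)]
  · intro j _ hj
    refine hv _ fun hinj => hj (hinj ?_)
    rw [Function.comp_apply, Function.comp_apply, Function.update_self,
      Function.update_of_ne hj.symm, hc]
  · simp

/-- The forms of all sections of `f` agree on a special flat. -/
theorem hookForm_section_eq {f : Fin n → Fin (l + 1)} {v : TabloidSpace n}
    (hv : ∀ c : Fin (l + 1) → Fin n, ¬ Function.Injective (f ∘ c) → hookForm c v = 0)
    {c d : Fin (l + 1) → Fin n} (hc : ∀ i, f (c i) = i) (hd : ∀ i, f (d i) = i) :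
    hookForm d v = hookForm c v := by
  -- The entries of `c` are exchanged for those of `d` one at a time, always through sections.
  suffices h : ∀ s : Finset (Fin (l + 1)), hookForm (s.piecewise d c) v = hookForm c v by
    have := h univ
    rwa [piecewise_univ] at this
  intro s
  induction s using Finset.induction_on with
  | empty => rw [piecewise_empty]
  | insert i s _ ih =>
    rw [← ih, piecewise_insert]
    have hs : ∀ j, f (s.piecewise d c j) = j := by
      intro j
      by_cases hj : j ∈ s
      · rw [piecewise_eq_of_mem _ _ _ hj, hd]
      · rw [piecewise_eq_of_notMem _ _ _ hj, hc]
    have := hookForm_update_eq hv hs (d i)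
    rwa [hd i] at this

/-- Every pairing either vanishes on the special flat or is, up to sign, the pairing with a section,
so a single number determines the vector. This bounds the dimension by one. -/
theorem eq_zero_of_hookForm_section_eq_zero (hl : 1 ≤ l) {f : Fin n → Fin (l + 1)}
    {v : specht (hook l n) n} (hv : v ∈ specialFlat l n f) {c : Fin (l + 1) → Fin n}
    (hc : ∀ i, f (c i) = i) (h : hookForm c v.1 = 0) : v = 0 := by
  rw [mem_specialFlat_iff hl] at hv
  apply Subtype.ext
  refine eq_zero_of_forall_hookForm_eq_zero hl v.2 fun d => ?_
  by_cases hd : Function.Injective (f ∘ d)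
  · let e := Equiv.ofBijective _ (Finite.injective_iff_bijective.1 hd)
    have hs : ∀ i, f ((d ∘ e.symm) i) = i := fun i => e.apply_symm_apply i
    have h1 : d = (d ∘ e.symm) ∘ e := by
      rw [Function.comp_assoc, Equiv.symm_comp_self, Function.comp_id]
    rw [h1, hookForm_comp_perm, hookForm_section_eq hv hc hs, h, smul_zero]
  · exact hv d hd

/-- The sum of the polytabloids of all sections of `f`. -/
noncomputable def sectionSum (f : Fin n → Fin (l + 1)) : TabloidSpace n :=
  ∑ c ∈ univ.filter (fun c : Fin (l + 1) → Fin n => ∀ i, f (c i) = i), hookPoly c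

/-- A transposition inside a fibre permutes the sections. Such invariance puts the vector in the
special flat. -/
theorem permAct_swap_sectionSum {f : Fin n → Fin (l + 1)} {a b : Fin n} (h : f a = f b) :
    permAct (Equiv.swap a b) (sectionSum f) = sectionSum f := by
  have hf : ∀ k, f (Equiv.swap a b k) = f k := congrFun (comp_swap_of_eq h)
  rw [sectionSum, map_sum, sum_congr rfl fun c _ => permAct_hookPoly _ c]
  refine sum_nbij' (fun c => Equiv.swap a b ∘ c) (fun c => Equiv.swap a b ∘ c) ?_ ?_ ?_ ?_ ?_
  · intro c hc
    simpa [hf] using hc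
  · intro c hc
    simpa [hf] using hc
  · intro c _
    ext1 i
    simp
  · intro c _
    ext1 i
    simp
  · intro c _
    rfl

theorem hookForm_sectionSum {f : Fin n → Fin (l + 1)} {c : Fin (l + 1) → Fin n}
    (hc : ¬ Function.Injective (f ∘ c)) : hookForm c (sectionSum f) = 0 := by
  obtain ⟨i, j, hij, hne⟩ := exists_ne_of_not_injective hc
  exact hookForm_eq_zero_of_permAct_swap hne (permAct_swap_sectionSum hij)

theorem sectionSum_mem_specht (hl : 1 ≤ l) (f : Fin n → Fin (l + 1)) :
    sectionSum f ∈ specht (hook l n) n :=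
  Submodule.sum_mem _ fun c _ => hookPoly_mem_specht hl c

/-- Applying `f` to an entry of a section recovers its position, so rows $1,\dots,l$ fix `σ` there,
and bijectivity fixes it at 0. Hence tabloids of sections occur in `sectionSum` only with sign $+1$,
without cancellation. -/
theorem eq_one_of_hookTabloid_comp_eq {f : Fin n → Fin (l + 1)} {c d : Fin (l + 1) → Fin n}
    (hc : ∀ i, f (c i) = i) (hd : ∀ i, f (d i) = i) {σ : Equiv.Perm (Fin (l + 1))}
    (h : hookTabloid (d ∘ σ) = hookTabloid c) : σ = 1 := by
  have hci : Function.Injective c := Function.LeftInverse.injective hc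
  have hdi : Function.Injective (d ∘ σ) :=
    (Function.LeftInverse.injective hd).comp σ.injective
  have key : ∀ i, i ≠ 0 → σ i = i := by
    intro i hi
    have h1 := congrFun h (c i)
    rw [hookTabloid_apply hci] at h1
    have h2 : c i ∈ Set.range (d ∘ σ) := by
      by_contra hcon
      rw [hookTabloid_apply_of_notMem hcon] at h1
      exact hi (Fin.ext h1.symm)
    obtain ⟨m, hm⟩ := h2
    rw [← hm, hookTabloid_apply hdi] at h1
    have h3 : m = i := Fin.ext h1
    subst h3
    have := congrArg f hm
    rwa [Function.comp_apply, hd, hc] at this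
  ext1 i
  rw [Equiv.Perm.one_apply]
  by_cases hi : i = 0
  · subst hi
    by_contra h0
    exact h0 (σ.injective (key _ h0))
  · exact key i hi

theorem sectionSum_ne_zero {f : Fin n → Fin (l + 1)} (hf : Function.Surjective f) :
    sectionSum f ≠ 0 := by
  obtain ⟨c, hc⟩ : ∃ c : Fin (l + 1) → Fin n, ∀ i, f (c i) = i :=
    ⟨Function.surjInv hf, Function.surjInv_eq hf⟩
  intro h0
  have h := congrFun h0 (hookTabloid c)
  have hterm : ∀ d ∈ univ.filter (fun d : Fin (l + 1) → Fin n => ∀ i, f (d i) = i),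
      hookPoly d (hookTabloid c) = ((if hookTabloid d = hookTabloid c then 1 else 0 : ℕ) : ℂ) := by
    intro d hd
    rw [hookPoly_apply, sum_eq_single 1]
    · simp
    · intro σ _ hσ
      exact if_neg fun h => hσ (eq_one_of_hookTabloid_comp_eq hc (mem_filter.1 hd).2 h)
    · simp
  rw [sectionSum, Finset.sum_apply, sum_congr rfl hterm, ← Nat.cast_sum, Pi.zero_apply,
    Nat.cast_eq_zero, sum_eq_zero_iff] at h
  have := h c (mem_filter.2 ⟨mem_univ _, hc⟩)
  simp at this

theorem sectionSum_mem_specialFlat (hl : 1 ≤ l) (f : Fin n → Fin (l + 1)) :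
    (⟨sectionSum f, sectionSum_mem_specht hl f⟩ : specht (hook l n) n) ∈ specialFlat l n f :=
  (mem_specialFlat_iff hl).2 fun _ hc => hookForm_sectionSum hc

theorem hookForm_sectionSum_ne_zero (hl : 1 ≤ l) {f : Fin n → Fin (l + 1)}
    {c : Fin (l + 1) → Fin n} (hc : ∀ i, f (c i) = i) : hookForm c (sectionSum f) ≠ 0 := by
  intro h
  have := eq_zero_of_hookForm_section_eq_zero hl (sectionSum_mem_specialFlat hl f) hc h
  exact sectionSum_ne_zero (fun i => ⟨c i, hc i⟩) (congrArg Subtype.val this)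

theorem finrank_specialFlat (hl : 1 ≤ l) {f : Fin n → Fin (l + 1)}
    (hf : Function.Surjective f) : Module.finrank ℂ (specialFlat l n f) = 1 := by
  obtain ⟨c, hc⟩ : ∃ c : Fin (l + 1) → Fin n, ∀ i, f (c i) = i :=
    ⟨Function.surjInv hf, Function.surjInv_eq hf⟩
  have hne := hookForm_sectionSum_ne_zero hl hc
  let s : specialFlat l n f := ⟨_, sectionSum_mem_specialFlat hl f⟩
  refine (finrank_eq_one_iff_of_nonzero' s fun h => sectionSum_ne_zero hf ?_).2 fun w => ?_
  · exact congrArg (fun x : specialFlat l n f => x.1.1) h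
  · refine ⟨hookForm c w.1.1 / hookForm c (sectionSum f), ?_⟩
    rw [← sub_eq_zero]
    apply Subtype.ext
    refine eq_zero_of_hookForm_section_eq_zero hl (Subtype.property _) hc ?_
    change hookForm c ((hookForm c w.1.1 / hookForm c (sectionSum f)) • sectionSum f - w.1.1) = 0
    rw [map_sub, map_smul, smul_eq_mul, div_mul_cancel₀ _ hne, sub_self]

/-- A special flat determines the kernel of the surjection. -/
theorem apply_eq_of_specialFlat_eq (hl : 1 ≤ l) {f g : Fin n → Fin (l + 1)}
    (hg : Function.Surjective g) (h : specialFlat l n f = specialFlat l n g) {a b : Fin n}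
    (hab : f a = f b) : g a = g b := by
  by_contra hne
  -- A section of `g` through both `a` and `b`. Its pairing with `sectionSum g` is nonzero, but
  -- vanishes on the flat of `f`, since `f a = f b`.
  let c := Function.update (Function.update (Function.surjInv hg) (g a) a) (g b) b
  have hcb : c (g b) = b := Function.update_self ..
  have hca : c (g a) = a := by
    rw [show c (g a) = _ from Function.update_of_ne hne .., Function.update_self]
  have hc : ∀ i, g (c i) = i := by
    intro i
    by_cases h1 : i = g b
    · rw [h1, hcb]
    · by_cases h2 : i = g a
      · rw [h2, hca]
      · rw [show c i = _ from Function.update_of_ne h1 .., Function.update_of_ne h2,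
          Function.surjInv_eq hg]
  have hmem := sectionSum_mem_specialFlat hl g
  rw [← h, mem_specialFlat_iff hl] at hmem
  refine hookForm_sectionSum_ne_zero hl hc (hmem c fun hinj => hne (hinj ?_))
  rw [Function.comp_apply, Function.comp_apply, hca, hcb, hab]

theorem stirlingSecond_le_card_specialFlats (hl : 1 ≤ l) (n : ℕ) :
    Nat.stirlingSecond n (l + 1) ≤ (specialFlats l n (l + 1)).card := by
  classical
  obtain ⟨A, h1, h2, h3⟩ := exists_surjections_card_eq_stirlingSecond n (l + 1)
  rw [← h3, ← card_image_of_injOn (s := A) (f := specialFlat l n)]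
  · refine card_le_card fun F hF => ?_
    obtain ⟨f, hf, rfl⟩ := mem_image.1 hF
    rw [specialFlats]
    exact mem_image_of_mem _ (mem_filter.2 ⟨mem_univ _, h1 f hf⟩)
  · intro f hf g hg h
    exact h2 f hf g hg fun a b =>
      ⟨apply_eq_of_specialFlat_eq hl (h1 g hg) h, apply_eq_of_specialFlat_eq hl (h1 f hf) h.symm⟩

theorem specialFlats_subset (hl : 1 ≤ l) (n : ℕ) :
    specialFlats l n (l + 1) ⊆ flatsOfCorank (hookArrangement l n) 1 := by
  classical
  intro F hF
  rw [specialFlats, mem_image] at hF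
  obtain ⟨f, hf, rfl⟩ := hF
  rw [flatsOfCorank, mem_filter]
  exact ⟨specialFlat_mem_flats f, finrank_specialFlat hl (mem_filter.1 hf).2⟩

end SpecialFlat

/-! ### Flats of rank one -/

section RankOne

variable {l n : ℕ}

theorem hyperplaneOf_injOn (hl : 1 ≤ l) {p q : Finset (Fin n)} (hp : p.card = l + 1)
    (hq : q.card = l + 1) (h : hyperplaneOf l p = hyperplaneOf l q) : p = q := by
  symm
  refine eq_of_subset_of_card_le (fun b hb => ?_) (hp.trans hq.symm).le
  by_contra hbp
  obtain ⟨c, hc, rfl⟩ := exists_injective_image_eq hp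
  obtain ⟨b', hb', hne⟩ := exists_mem_ne (by omega : 1 < q.card) b
  -- For `b` in `q` but not in `p`, take a retraction onto the positions of `p` that identifies `b`
  -- with another element of `q`. The vector `sectionSum g` then lies in the hyperplane of `q` and
  -- not in that of `p`.
  let g := Function.update (Function.invFun c) b (Function.invFun c b')
  have hgc : ∀ i, g (c i) = i := by
    intro i
    rw [show g (c i) = _ from Function.update_of_ne
      (fun h : c i = b => hbp (mem_image.2 ⟨i, mem_univ _, h⟩)) ..]
    exact Function.leftInverse_invFun hc i
  have hg : g b = g b' := by
    rw [show g b = _ from Function.update_self .., show g b' = _ from Function.update_of_ne hne ..]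
  have hmem : (⟨sectionSum g, sectionSum_mem_specht hl g⟩ : specht (hook l n) n) ∈
      hyperplaneOf l q := by
    refine (mem_specialFlat hl).1 (sectionSum_mem_specialFlat hl g) q hq ?_
    refine lt_of_lt_of_eq (lt_of_le_of_ne card_image_le fun h' => hne ?_) hq
    exact card_image_iff.1 h' hb' hb hg.symm
  rw [← h, mem_hyperplaneOf_image hl hc] at hmem
  exact hookForm_sectionSum_ne_zero hl hgc hmem

theorem finrank_quotient_hyperplaneOf (hl : 1 ≤ l) {p : Finset (Fin n)} (hp : p.card = l + 1) :
    Module.finrank ℂ (specht (hook l n) n ⧸ hyperplaneOf l p) = 1 := by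
  obtain ⟨c, hc, rfl⟩ := exists_injective_image_eq hp
  let φ : specht (hook l n) n →ₗ[ℂ] ℂ := hookForm c ∘ₗ (specht (hook l n) n).subtype
  have hker : hyperplaneOf l (univ.image c) = LinearMap.ker φ := by
    ext v
    rw [mem_hyperplaneOf_image hl hc]
    rfl
  have hφ : φ ≠ 0 := by
    intro h
    let g := Function.invFun c
    exact hookForm_sectionSum_ne_zero hl (Function.leftInverse_invFun hc)
      (DFunLike.congr_fun h ⟨sectionSum g, sectionSum_mem_specht hl g⟩)
  rw [hker, (φ.quotKerEquivOfSurjective (LinearMap.surjective hφ)).finrank_eq,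
    Module.finrank_self]

theorem mem_flatsOfRank_one (hl : 1 ≤ l) {F : Submodule ℂ (specht (hook l n) n)} :
    F ∈ flatsOfRank (hookArrangement l n) 1 ↔ F ∈ hookArrangement l n := by
  classical
  rw [flatsOfRank, mem_filter]
  constructor
  · rintro ⟨hF, hrank⟩
    rw [flats, mem_image] at hF
    obtain ⟨ℬ, hℬ, rfl⟩ := hF
    rw [mem_powerset] at hℬ
    obtain ⟨H, hH⟩ : ℬ.Nonempty := by
      rw [nonempty_iff_ne_empty]
      rintro rfl
      rw [inf_empty, Module.finrank_zero_of_subsingleton] at hrank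
      exact zero_ne_one hrank
    obtain ⟨p, hp, rfl⟩ := (mem_hookArrangement hl).1 (hℬ hH)
    have hle : ℬ.inf id ≤ hyperplaneOf l p := inf_le hH
    have h1 := finrank_quotient_hyperplaneOf hl hp
    have h2 := Submodule.finrank_quotient_add_finrank (hyperplaneOf l p)
    have h3 := Submodule.finrank_quotient_add_finrank (ℬ.inf id)
    rw [Submodule.eq_of_le_of_finrank_eq hle (by omega)]
    exact hℬ hH
  · intro hF
    refine ⟨?_, ?_⟩
    · have := inf_mem_flats (singleton_subset_iff.2 hF)
      rwa [inf_singleton] at this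
    · obtain ⟨p, hp, rfl⟩ := (mem_hookArrangement hl).1 hF
      exact finrank_quotient_hyperplaneOf hl hp

theorem card_flatsOfRank_one (hl : 1 ≤ l) (n : ℕ) :
    (flatsOfRank (hookArrangement l n) 1).card = n.choose (l + 1) := by
  classical
  have h : flatsOfRank (hookArrangement l n) 1 =
      (powersetCard (l + 1) (univ : Finset (Fin n))).image (hyperplaneOf l) := by
    ext F
    rw [mem_flatsOfRank_one hl, mem_hookArrangement hl, mem_image]
    simp only [mem_powersetCard, subset_univ, true_and]
  rw [h, card_image_of_injOn, card_powersetCard, card_univ, Fintype.card_fin]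
  intro p hp q hq
  rw [mem_coe, mem_powersetCard] at hp hq
  exact hyperplaneOf_injOn hl hp.2 hq.2

/-- The arrangement is essential, so the matroid has rank $\dim S_n$ and the coatoms are the
one-dimensional flats. -/
theorem inf_hookArrangement (hl : 1 ≤ l) (n : ℕ) : (hookArrangement l n).inf id = ⊥ := by
  rw [eq_bot_iff]
  intro v hv
  rw [Submodule.mem_finsetInf] at hv
  rw [Submodule.mem_bot]
  apply Subtype.ext
  refine eq_zero_of_forall_hookForm_eq_zero hl v.2 fun c => ?_
  by_cases hc : Function.Injective c
  · rw [← mem_hyperplaneOf_image hl hc]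
    refine hv _ ((mem_hookArrangement hl).2 ⟨_, ?_, rfl⟩)
    rw [card_image_of_injective _ hc, card_univ, Fintype.card_fin]
  · exact hookForm_eq_zero hc _

end RankOne

/-! ### The first coefficient of an essential arrangement -/

section FirstKL

variable {V : Type*} [AddCommGroup V] [Module ℂ V]

theorem card_filter_flatLattice (𝒜 : Finset (Submodule ℂ V)) (P : Submodule ℂ V → Prop)
    [DecidablePred P] [DecidablePred fun F : FlatLattice 𝒜 => P (OrderDual.ofDual F).1]
    (s : Finset (FlatLattice 𝒜)) (hs : ∀ F, F ∈ s) :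
    (s.filter fun F => P (OrderDual.ofDual F).1).card = ((flats 𝒜).filter P).card := by
  refine card_bij (fun F _ => (OrderDual.ofDual F).1) ?_ ?_ ?_
  · intro F hF
    exact mem_filter.2 ⟨(OrderDual.ofDual F).2, (mem_filter.1 hF).2⟩
  · intro F _ G _ h
    exact Subtype.ext h
  · intro F hF
    obtain ⟨h1, h2⟩ := mem_filter.1 hF
    exact ⟨OrderDual.toDual ⟨F, h1⟩, mem_filter.2 ⟨hs _, h2⟩, rfl⟩

theorem flatRank_wholeFlat (𝒜 : Finset (Submodule ℂ V)) : flatRank 𝒜 (wholeFlat 𝒜) = 0 := by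
  change Module.finrank ℂ (V ⧸ (∅ : Finset (Submodule ℂ V)).inf id) = 0
  rw [inf_empty, Module.finrank_zero_of_subsingleton]

theorem mem_Icc_wholeFlat_centerFlat {𝒜 : Finset (Submodule ℂ V)} (F : FlatLattice 𝒜) :
    F ∈ Icc (wholeFlat 𝒜) (centerFlat 𝒜) := by
  classical
  rw [mem_Icc]
  constructor
  · change (OrderDual.ofDual F).1 ≤ (∅ : Finset (Submodule ℂ V)).inf id
    rw [inf_empty]
    exact le_top
  · change 𝒜.inf id ≤ (OrderDual.ofDual F).1
    have h : (OrderDual.ofDual F).1 ∈ flats 𝒜 := (OrderDual.ofDual F).2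
    obtain ⟨ℬ, hℬ, hF⟩ := mem_image.1 h
    rw [← hF]
    exact inf_mono (mem_powerset.1 hℬ)

variable [FiniteDimensional ℂ V]

theorem flatRank_centerFlat {𝒜 : Finset (Submodule ℂ V)} (h𝒜 : 𝒜.inf id = ⊥) :
    flatRank 𝒜 (centerFlat 𝒜) = Module.finrank ℂ V := by
  have := Submodule.finrank_quotient_add_finrank (⊥ : Submodule ℂ V)
  rw [finrank_bot, add_zero] at this
  change Module.finrank ℂ (V ⧸ 𝒜.inf id) = Module.finrank ℂ V
  rw [h𝒜, this]

theorem firstKLCoeff_eq {𝒜 : Finset (Submodule ℂ V)} (h𝒜 : 𝒜.inf id = ⊥)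
    (hV : 2 < Module.finrank ℂ V) :
    firstKLCoeff 𝒜 = ((flatsOfCorank 𝒜 1).card : ℤ) - (flatsOfRank 𝒜 1).card := by
  classical
  have h0 := flatRank_wholeFlat 𝒜
  have h1 := flatRank_centerFlat h𝒜
  have hmem := mem_Icc_wholeFlat_centerFlat (𝒜 := 𝒜)
  rw [firstKLCoeff, klPolynomial, coeff_one_klPoly (flatRank_strictMono 𝒜)
    (mem_Icc.1 (hmem (wholeFlat 𝒜))).2 (by rw [h0, h1]; omega), h0, h1]
  congr 2
  · rw [flatsOfCorank, ← card_filter_flatLattice 𝒜 (fun F => Module.finrank ℂ F = 1) _ hmem]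
    congr 1
    refine filter_congr fun F _ => ?_
    have := Submodule.finrank_quotient_add_finrank (OrderDual.ofDual F).1
    rw [flatRank]
    omega
  · rw [flatsOfRank,
      ← card_filter_flatLattice 𝒜 (fun F => Module.finrank ℂ (V ⧸ F) = 1) _ hmem]
    congr 1

theorem firstKLCoeff_eq_zero {𝒜 : Finset (Submodule ℂ V)} (h𝒜 : 𝒜.inf id = ⊥)
    (hV : Module.finrank ℂ V ≤ 2) : firstKLCoeff 𝒜 = 0 := by
  classical
  have h0 := flatRank_wholeFlat 𝒜
  have h1 := flatRank_centerFlat h𝒜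
  rw [firstKLCoeff, klPolynomial]
  by_cases h : wholeFlat 𝒜 = centerFlat 𝒜
  · rw [h, klPoly_self, coeff_one, if_neg one_ne_zero]
  · rw [coeff_klPoly _ h, if_neg (by rw [h0, h1]; omega)]

theorem card_flatsOfCorank_one_le_of_finrank_le_one {𝒜 : Finset (Submodule ℂ V)}
    (hV : Module.finrank ℂ V ≤ 1) : (flatsOfCorank 𝒜 1).card ≤ 1 := by
  classical
  rw [card_le_one]
  have key : ∀ F ∈ flatsOfCorank 𝒜 1, F = ⊤ := by
    intro F hF
    rw [flatsOfCorank, mem_filter] at hF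
    refine Submodule.eq_top_of_finrank_eq ?_
    have := Submodule.finrank_le F
    omega
  intro F hF G hG
  rw [key F hF, key G hG]

theorem flatsOfCorank_one_eq_of_finrank_eq_two {𝒜 : Finset (Submodule ℂ V)}
    (hV : Module.finrank ℂ V = 2) : flatsOfCorank 𝒜 1 = flatsOfRank 𝒜 1 := by
  classical
  rw [flatsOfCorank, flatsOfRank]
  refine filter_congr fun F _ => ?_
  have := Submodule.finrank_quotient_add_finrank F
  omega

end FirstKL

/-! ### The lower bound in all ranks -/

theorem stirlingSecond_sub_choose_le_firstKLCoeff {l : ℕ} (hl : 1 ≤ l) (n : ℕ) :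
    ((Nat.stirlingSecond n (l + 1) - n.choose (l + 1) : ℕ) : ℤ) ≤
      firstKLCoeff (hookArrangement l n) := by
  have hinf := inf_hookArrangement hl n
  have h1 := choose_le_stirlingSecond n (k := l + 1) (by omega)
  have h2 := (stirlingSecond_le_card_specialFlats hl n).trans
    (card_le_card (specialFlats_subset hl n))
  have h3 := card_flatsOfRank_one hl n
  rcases lt_or_ge 2 (Module.finrank ℂ (specht (hook l n) n)) with h | h
  · rw [firstKLCoeff_eq hinf h]
    omega
  -- In dimension at most two the coefficient is 0, so $S(n,l+1)\le\binom{n}{l+1}$ is needed. In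
  -- dimension at most one there is at most one special flat; in dimension two, corank one is rank
  -- one.
  · rw [firstKLCoeff_eq_zero hinf h]
    rcases h.lt_or_eq with h | h
    · have h4 := card_flatsOfCorank_one_le_of_finrank_le_one (𝒜 := hookArrangement l n) (by omega)
      rcases Nat.lt_or_ge n (l + 1) with hn | hn
      · rw [Nat.stirlingSecond_eq_zero_of_lt hn]
        simp
      · have h5 := Nat.choose_pos hn
        omega
    · rw [← flatsOfCorank_one_eq_of_finrank_eq_two h] at h3
      omega

end Intrinsic

theorem mainTheorem3 (l : ℕ) (hl : 1 ≤ l) :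
    (∃ f : ℕ → ℕ,
      (∀ n : ℕ, (f n : ℤ) ≤ Intrinsic.firstKLCoeff (Intrinsic.hookArrangement l n)) ∧
      Filter.Tendsto (fun n : ℕ => (f n : ℝ) * ((l + 1).factorial : ℝ) / ((l : ℝ) + 1) ^ n)
        Filter.atTop (nhds 1)) ∧
    (∀ n : ℕ,
      Intrinsic.specialFlats l n (l + 1) ⊆
        Intrinsic.flatsOfCorank (Intrinsic.hookArrangement l n) 1 ∧
      Nat.stirlingSecond n (l + 1) ≤ (Intrinsic.specialFlats l n (l + 1)).card ∧
      (Intrinsic.flatsOfRank (Intrinsic.hookArrangement l n) 1).card = n.choose (l + 1)) := by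
  refine ⟨⟨fun n => Nat.stirlingSecond n (l + 1) - n.choose (l + 1),
    Intrinsic.stirlingSecond_sub_choose_le_firstKLCoeff hl, ?_⟩,
    fun n => ⟨Intrinsic.specialFlats_subset hl n,
      Intrinsic.stirlingSecond_le_card_specialFlats hl n, Intrinsic.card_flatsOfRank_one hl n⟩⟩
  have hl' : (1 : ℝ) < (l : ℝ) + 1 := by
    have : (1 : ℝ) ≤ l := by exact_mod_cast hl
    linarith
  have h1 := Intrinsic.tendsto_stirlingSecond_mul_factorial_div_pow (Nat.succ_pos l)
  have h2 := (Intrinsic.tendsto_choose_div_pow (l + 1) hl').mul_const ((l + 1).factorial : ℝ)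
  have h3 := h1.sub h2
  rw [zero_mul, sub_zero] at h3
  refine h3.congr fun n => ?_
  -- No truncation occurs, since $l+1\ge 2$.
  rw [Nat.cast_sub (Intrinsic.choose_le_stirlingSecond n (by omega))]
  push_cast
  ring
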